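/- Let $n\ge 0$, $M\ge 2$ and $N_r\ge 1$ be integers. For $K\ge1$ let $\mathcal S_K=\{e^{j(\pi/4+2\pi i/K)}: i=0,\dots,K-1\}$, and let $\mathscr Q_{\mathcal S_K}:\mathbb C\to\mathcal S_K$ be a nearest-point quantizer, i.e. $\mathscr Q_{\mathcal S_K}(x)\in\arg\min_{s\in\mathcal S_K}|s-x|$, with ties broken in an arbitrary fixed way. Consider the $M$-PSK-modulated, $n$-bit phase-quantized SIMO system with maximal-ratio combining and perfect channel knowledge at the receiver: the symbol $s$ is uniform on $\mathcal S_M$, the channel $\mathbf h$ and the noise $\mathbf n$ have law $\mathcal{CN}(\mathbf 0,\mathbf I_{N_r})$, and $s,\mathbf h,\mathbf n$ are independent; the received signal at transmit SNR $\rho$ is $\mathbf y=\sqrt{\rho}\,\mathbf h s+\mathbf n$, its quantized version is $\mathbf r=\mathscr Q_{\mathcal S_{2^n}}(\mathbf y)$ (applied entrywise), and the detected symbol is $\hat s=\mathscr Q_{\mathcal S_M}(\mathbf h^{\mathrm H}\mathbf r)$. Let $\mathscr P(\rho)=\Pr\{\hat s\ne s\}$ be the average symbol error probability. Then the system has diversity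 gain $$G_d=\begin{cases}0,&2^n<M,\\ N_r/2,&2^n=M,\\ N_r,&2^n>M,\end{cases}$$ that is, there is a constant $c>0$ (depending on $n$, $M$, $N_r$) with $\mathscr P(\rho)\sim c\,\rho^{-G_d}$ as $\rho\to\infty$. For $G_d>0$ this means $\mathscr P(\rho)\sim(G_c\rho)^{-G_d}$ with a coding gain $G_c=c^{-1/G_d}\in(0,\infty)$; for $G_d=0$ it means that $\mathscr P(\rho)$ tends to a positive error floor. -/

import Mathlib

open MeasureTheory ProbabilityTheory Filter Asymptotics
open scoped NNReal Matrix

noncomputable section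

/-- The `K`-point phase-shift-keying constellation
`{exp(j(π/4 + 2π i / K)) : i = 0, …, K - 1}`. -/
def psk (K : ℕ) : Set ℂ :=
  {z | ∃ i : ℕ, i < K ∧
    z = Complex.exp (((Real.pi / 4 + 2 * Real.pi / K * i : ℝ) : ℂ) * Complex.I)}

/-- `Q` is a minimum-distance quantizer onto the `K`-point constellation: `Q x` is a nearest
constellation point of `x`, with an arbitrary choice at ties. With `K = 2 ^ n` this is the
`n`-bit phase quantizer. -/
def IsPhaseQuantizer (K : ℕ) (Q : ℂ → ℂ) : Prop :=
  ∀ x : ℂ, Q x ∈ psk K ∧ ∀ s ∈ psk K, ‖Q x - x‖ ≤ ‖s - x‖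

/-- The circularly symmetric complex Gaussian law `CN(0, 1)` on `ℂ`: the real and imaginary parts
are independent centred real Gaussians, each of variance `1 / 2`. -/
def complexGaussian : Measure ℂ :=
  ((gaussianReal 0 (1 / 2)).prod (gaussianReal 0 (1 / 2))).map
    (fun p : ℝ × ℝ => (⟨p.1, p.2⟩ : ℂ))

/-- The law `CN(0, I_N)` on `ℂ^N`. -/
def complexGaussianVec (N : ℕ) : Measure (Fin N → ℂ) :=
  Measure.pi fun _ => complexGaussian

/-- The joint law of `(s, h, w)`, where the symbol `s` is uniform on the `M`-PSK constellation,
the channel `h` and the noise `w` are `CN(0, I_N)`, and the three are independent. -/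
def simoLaw (M N : ℕ) : Measure (ℂ × (Fin N → ℂ) × (Fin N → ℂ)) :=
  (uniformOn (psk M)).prod ((complexGaussianVec N).prod (complexGaussianVec N))

/-- The received vector `y = √ρ h s + w` before quantization. -/
def receivedSignal {N : ℕ} (ρ : ℝ) (s : ℂ) (h w : Fin N → ℂ) : Fin N → ℂ :=
  fun i => (Real.sqrt ρ : ℂ) * h i * s + w i

/-- The detected symbol: the quantizer `Q` is applied to every antenna output, the quantized vector
`r` is combined into `hᴴ r`, and the minimum-distance detector `D` is applied. -/
def mrcDetect {N : ℕ} (Q D : ℂ → ℂ) (h y : Fin N → ℂ) : ℂ :=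
  D (star h ⬝ᵥ fun i => Q (y i))

/-- The average symbol error probability `P(ŝ ≠ s)` at transmit SNR `ρ`. -/
def averageSEP (M N : ℕ) (Q D : ℂ → ℂ) (ρ : ℝ) : ℝ :=
  (simoLaw M N).real
    {ω | mrcDetect Q D ω.2.1 (receivedSignal ρ ω.1 ω.2.1 ω.2.2) ≠ ω.1}

/-- The error probability `P` has diversity gain `d`: `P ρ ~ c ρ ^ (-d)` as `ρ → ∞` for some
constant `c > 0`. For `d > 0` this reads `P ρ ~ (G ρ) ^ (-d)` with coding gain
`G = c ^ (-1 / d)`; for `d = 0` it says that `P` tends to a positive error floor. -/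
def HasDiversityGain (P : ℝ → ℝ) (d : ℝ) : Prop :=
  ∃ c : ℝ, 0 < c ∧ P ~[atTop] fun ρ => c * ρ ^ (-d)

end

/-! All sectors are cut out by the real linear forms `edge δ t = Im (t e^{iδ})`. For `K ≥ 2` a
`K`-level quantizer makes `edge (π/K)` nonnegative on `star y * Q y` and on its conjugate
(`IsPSKQuantizer.edge_nonneg`). Up to ties, the detector is right iff `edge (π/M)` is positive on
the combined signal, rotated by the symbol, and on its conjugate. Ties are null and the Gaussian law
is circularly symmetric, so the symbol can be rotated away and the quantizer replaced by a
measurable one (`averageSEP_eq`).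

Let `K = 2 ^ n`, let `x = √ρ h` be the noiseless signal and `y = x + w`.

If `K < M`, the noise stops affecting the quantized outputs for almost every channel. The error
event converges to an event about `h` alone, which has positive probability because on an open cone
quantization by itself leaves the decision sector (`tendsto_error_floor`).

If `K > M`, the form at `π/M` is at least `c |y_i|` on each antenna. These terms cannot cancel and
the noise changes their sum by at most `∑ |w_i|`, so an error forces every `|x_i|` to be of the
order of the noise. The substitution `x = √ρ h` in `2N` real dimensions yields `ρ^{-N}`.

If `K = M`, the form vanishes on cell boundaries, and an error only forces each `x_i` to be within
the order of the noise of a boundary line. After splitting by the nearest boundary ray and rotating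
it to the positive real axis, only the `N` normal components are rescaled, which yields `ρ^{-N/2}`.

Both scaling limits come from `tendsto_rpow_mul_measureReal_scaled`: the rescaled Gaussian density
tends to a constant, and finite noise moments supply the domination. -/

/-! ### Points of the unit circle and circular sectors -/

/-- The point of the unit circle with angle `θ`. -/
noncomputable def cis (θ : ℝ) : ℂ := ⟨Real.cos θ, Real.sin θ⟩

@[simp] lemma cis_re (θ : ℝ) : (cis θ).re = Real.cos θ := rfl

@[simp] lemma cis_im (θ : ℝ) : (cis θ).im = Real.sin θ := rfl

lemma exp_mul_I_eq_cis (θ : ℝ) : Complex.exp ((θ : ℂ) * Complex.I) = cis θ := by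
  apply Complex.ext
  · simp [Complex.exp_ofReal_mul_I_re]
  · simp [Complex.exp_ofReal_mul_I_im]

lemma cis_add (a b : ℝ) : cis (a + b) = cis a * cis b := by
  apply Complex.ext
  · simp [Real.cos_add]
  · simp [Real.sin_add]; ring

lemma star_cis (a : ℝ) : star (cis a) = cis (-a) := by
  apply Complex.ext <;> simp

@[simp] lemma cis_zero : cis 0 = 1 := by
  apply Complex.ext <;> simp

@[simp] lemma cis_pi : cis Real.pi = -1 := by
  apply Complex.ext <;> simp

lemma cis_mul_star (a : ℝ) : cis a * star (cis a) = 1 := by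
  rw [star_cis, ← cis_add]; simp

lemma star_mul_cis (a : ℝ) : star (cis a) * cis a = 1 := by
  rw [mul_comm, cis_mul_star]

@[simp] lemma norm_cis (a : ℝ) : ‖cis a‖ = 1 := by
  rw [← exp_mul_I_eq_cis]; exact Complex.norm_exp_ofReal_mul_I a

lemma cis_ne_zero (a : ℝ) : cis a ≠ 0 := by
  intro h; have := norm_cis a; rw [h] at this; simp at this

lemma cis_int_mul_two_pi (k : ℤ) : cis (k * (2 * Real.pi)) = 1 := by
  apply Complex.ext
  · simp [Real.cos_int_mul_two_pi]
  · have := Real.sin_int_mul_pi (2 * k)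
    simp only [cis_im, Complex.one_im]
    rw [← this]; congr 1; push_cast; ring

/-- The linear form whose zero set is the line with angle `-δ`. -/
noncomputable def edge (δ : ℝ) (t : ℂ) : ℝ := (t * cis δ).im

lemma edge_def (δ : ℝ) (t : ℂ) : edge δ t = t.re * Real.sin δ + t.im * Real.cos δ := by
  simp [edge]

lemma edge_star (δ : ℝ) (t : ℂ) : edge δ (star t) = t.re * Real.sin δ - t.im * Real.cos δ := by
  simp [edge]; ring

lemma edge_add (δ : ℝ) (s t : ℂ) : edge δ (s + t) = edge δ s + edge δ t := by
  simp only [edge_def, Complex.add_re, Complex.add_im]; ring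

lemma edge_sub (δ : ℝ) (s t : ℂ) : edge δ (s - t) = edge δ s - edge δ t := by
  simp only [edge_def, Complex.sub_re, Complex.sub_im]; ring

lemma edge_ofReal_mul (δ r : ℝ) (t : ℂ) : edge δ ((r : ℂ) * t) = r * edge δ t := by
  simp only [edge_def, Complex.re_ofReal_mul, Complex.im_ofReal_mul]; ring

lemma edge_sum {ι : Type*} (s : Finset ι) (δ : ℝ) (f : ι → ℂ) :
    edge δ (∑ i ∈ s, f i) = ∑ i ∈ s, edge δ (f i) := by
  simp only [edge, Finset.sum_mul, Complex.im_sum]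

lemma abs_edge_le (δ : ℝ) (t : ℂ) : |edge δ t| ≤ ‖t‖ := by
  refine (Complex.abs_im_le_norm _).trans ?_
  rw [norm_mul, norm_cis, mul_one]

lemma continuous_edge (δ : ℝ) : Continuous (edge δ) := by
  unfold edge; fun_prop

/-- The open sector of half-angle `π / M` around the positive real axis. -/
def InSector (M : ℕ) (t : ℂ) : Prop :=
  0 < edge (Real.pi / M) t ∧ 0 < edge (Real.pi / M) (star t)

lemma InSector.ofReal_mul {M : ℕ} {t : ℂ} {r : ℝ} (hr : 0 < r) :
    InSector M ((r : ℂ) * t) ↔ InSector M t := by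
  have : star ((r : ℂ) * t) = (r : ℂ) * star t := by simp
  unfold InSector
  rw [this, edge_ofReal_mul, edge_ofReal_mul, mul_pos_iff_of_pos_left hr,
    mul_pos_iff_of_pos_left hr]

lemma isOpen_inSector (M : ℕ) : IsOpen {t | InSector M t} := by
  have h1 := continuous_edge (Real.pi / M)
  exact (isOpen_lt continuous_const h1).inter
    (isOpen_lt continuous_const (h1.comp continuous_star))

/-! ### Nearest-point quantizers onto phase-shift-keying constellations -/

/-- The `k`-th point of the `K`-point constellation with initial angle `β`. -/
noncomputable def pskPt (K : ℕ) (β : ℝ) (k : ℤ) : ℂ := cis (β + 2 * Real.pi / K * k)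

/-- `Q` is a nearest-point quantizer onto the `K`-point constellation with initial angle `β`. -/
def IsPSKQuantizer (K : ℕ) (β : ℝ) (Q : ℂ → ℂ) : Prop :=
  ∀ x, (∃ k : ℤ, Q x = pskPt K β k) ∧
    ∀ k : ℤ, (x * star (pskPt K β k)).re ≤ (x * star (Q x)).re

lemma pskPt_add_mul (K : ℕ) (hK : 1 ≤ K) (β : ℝ) (k m : ℤ) :
    pskPt K β (k + K * m) = pskPt K β k := by
  have hK' : (K : ℝ) ≠ 0 := by positivity
  unfold pskPt
  have : β + 2 * Real.pi / K * ((k + K * m : ℤ) : ℝ)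
      = (β + 2 * Real.pi / K * k) + m * (2 * Real.pi) := by
    push_cast; field_simp; ring
  rw [this, cis_add, cis_int_mul_two_pi, mul_one]

lemma pskPt_add (K : ℕ) (β : ℝ) (k m : ℤ) :
    pskPt K β (k + m) = pskPt K β k * cis (2 * Real.pi / K * m) := by
  unfold pskPt
  rw [← cis_add]; congr 1; push_cast; ring

lemma pskPt_emod (K : ℕ) (hK : 1 ≤ K) (β : ℝ) (k : ℤ) :
    pskPt K β (k % K) = pskPt K β k := by
  conv_rhs => rw [← Int.emod_add_mul_ediv k K]
  rw [pskPt_add_mul K hK]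

lemma exists_lt_pskPt_eq (K : ℕ) (hK : 1 ≤ K) (β : ℝ) (k : ℤ) :
    ∃ i : ℕ, i < K ∧ pskPt K β k = pskPt K β i := by
  have h0 : 0 ≤ k % (K : ℤ) := Int.emod_nonneg _ (by omega)
  have h1 : k % (K : ℤ) < K := Int.emod_lt_of_pos _ (by omega)
  refine ⟨(k % K).toNat, by omega, ?_⟩
  rw [Int.toNat_of_nonneg h0, pskPt_emod K hK]

lemma finite_range_pskPt (K : ℕ) (hK : 1 ≤ K) (β : ℝ) : (Set.range (pskPt K β)).Finite := by
  refine (Set.finite_range fun i : Fin K => pskPt K β (i : ℕ)).subset ?_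
  rintro _ ⟨k, rfl⟩
  obtain ⟨i, hi, h⟩ := exists_lt_pskPt_eq K hK β k
  exact ⟨⟨i, hi⟩, h.symm⟩

lemma psk_eq_range (K : ℕ) (hK : 1 ≤ K) : psk K = Set.range (pskPt K (Real.pi / 4)) := by
  ext z
  simp only [psk, Set.mem_ofPred_eq, Set.mem_range]
  constructor
  · rintro ⟨i, -, rfl⟩
    exact ⟨i, by rw [exp_mul_I_eq_cis]; simp [pskPt]⟩
  · rintro ⟨k, rfl⟩
    obtain ⟨i, hi, h⟩ := exists_lt_pskPt_eq K hK (Real.pi / 4) k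
    exact ⟨i, hi, by rw [exp_mul_I_eq_cis, h]; simp [pskPt]⟩

/-- For unit `c` one has `‖c - x‖² = 1 + ‖x‖² - 2 Re (x * star c)`, so nearest means largest inner
product. This makes the quantizer condition linear in `x`. -/
lemma norm_sub_le_norm_sub_iff_re {a b x : ℂ} (ha : ‖a‖ = 1) (hb : ‖b‖ = 1) :
    ‖a - x‖ ≤ ‖b - x‖ ↔ (x * star b).re ≤ (x * star a).re := by
  have h : ∀ c : ℂ, ‖c‖ = 1 → ‖c - x‖ ^ 2 = 1 + ‖x‖ ^ 2 - 2 * (x * star c).re := by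
    intro c hc
    have h1 : c.re * c.re + c.im * c.im = 1 := by
      have := Complex.normSq_eq_norm_sq c
      rw [Complex.normSq_apply, hc] at this; simpa using this
    rw [← Complex.normSq_eq_norm_sq, ← Complex.normSq_eq_norm_sq, Complex.normSq_apply,
      Complex.normSq_apply]
    simp
    linear_combination h1
  rw [← abs_of_nonneg (norm_nonneg (a - x)), ← abs_of_nonneg (norm_nonneg (b - x)), ← sq_le_sq,
    h a ha, h b hb]
  constructor <;> intro h <;> linarith

lemma norm_pskPt (K : ℕ) (β : ℝ) (k : ℤ) : ‖pskPt K β k‖ = 1 := norm_cis _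

lemma IsPhaseQuantizer.isPSKQuantizer {K : ℕ} (hK : 1 ≤ K) {Q : ℂ → ℂ}
    (h : IsPhaseQuantizer K Q) : IsPSKQuantizer K (Real.pi / 4) Q := by
  intro x
  obtain ⟨h1, h2⟩ := h x
  rw [psk_eq_range K hK] at h1 h2
  obtain ⟨k, hk⟩ := h1
  refine ⟨⟨k, hk.symm⟩, fun m => ?_⟩
  rw [← norm_sub_le_norm_sub_iff_re (by rw [← hk]; exact norm_pskPt _ _ _) (norm_pskPt _ _ _)]
  exact h2 _ ⟨m, rfl⟩

/-- Arbitrary tie-breaking may destroy measurability; `SimpleFunc.nearestPt` breaks ties measurably.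
Its index bound is inclusive, hence `K - 1` for `K` points. -/
lemma exists_measurable_isPSKQuantizer (K : ℕ) (hK : 1 ≤ K) (β : ℝ) :
    ∃ Q : ℂ → ℂ, Measurable Q ∧ IsPSKQuantizer K β Q := by
  let e : ℕ → ℂ := fun i => pskPt K β i
  have key : ∀ x, ∃ k : ℤ, SimpleFunc.nearestPt e (K - 1) x = pskPt K β k := fun x =>
    ⟨(SimpleFunc.nearestPtInd e (K - 1) x : ℕ), rfl⟩
  refine ⟨SimpleFunc.nearestPt e (K - 1), SimpleFunc.measurable _, fun x => ⟨key x, ?_⟩⟩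
  intro k
  obtain ⟨m, hm⟩ := key x
  obtain ⟨i, hi, h⟩ := exists_lt_pskPt_eq K hK β k
  have := SimpleFunc.edist_nearestPt_le e x (k := i) (N := K - 1) (by omega)
  rw [edist_dist, edist_dist, ENNReal.ofReal_le_ofReal_iff dist_nonneg, dist_eq_norm,
    dist_eq_norm, norm_sub_le_norm_sub_iff_re (by rw [hm]; exact norm_pskPt _ _ _)
      (norm_pskPt _ _ _)] at this
  rwa [h]

namespace IsPSKQuantizer

variable {K : ℕ} {β : ℝ} {Q : ℂ → ℂ}

lemma norm_eq (h : IsPSKQuantizer K β Q) (x : ℂ) : ‖Q x‖ = 1 := by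
  obtain ⟨k, hk⟩ := (h x).1
  rw [hk, norm_pskPt]

/-- Conjugating a quantizer by a rotation rotates the constellation. -/
lemma rotate (h : IsPSKQuantizer K β Q) (φ : ℝ) :
    IsPSKQuantizer K (β - φ) (fun y => star (cis φ) * Q (cis φ * y)) := by
  have hp : ∀ k, pskPt K (β - φ) k = star (cis φ) * pskPt K β k := by
    intro k
    rw [star_cis, pskPt, pskPt, ← cis_add]; congr 1; ring
  intro x
  obtain ⟨⟨k, hk⟩, h2⟩ := h (cis φ * x)
  refine ⟨⟨k, by simp only [hk, hp]⟩, fun m => ?_⟩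
  have e : ∀ z, x * star (star (cis φ) * z) = cis φ * x * star z := by
    intro z; simp only [star_mul', star_star]; ring
  rw [hp, e, e]
  exact h2 m

lemma shift (h : IsPSKQuantizer K β Q) (m : ℤ) :
    IsPSKQuantizer K (β + 2 * Real.pi / K * m) Q := by
  have hp : ∀ k, pskPt K (β + 2 * Real.pi / K * m) k = pskPt K β (k + m) := by
    intro k; unfold pskPt; congr 1; push_cast; ring
  intro x
  obtain ⟨⟨k, hk⟩, h2⟩ := h x
  refine ⟨⟨k - m, by rw [hp, hk]; congr 1; ring⟩, fun j => by rw [hp]; exact h2 _⟩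

end IsPSKQuantizer

lemma sin_pi_div_pos {K : ℕ} (hK : 2 ≤ K) : 0 < Real.sin (Real.pi / K) := by
  have : (2 : ℝ) ≤ K := by exact_mod_cast hK
  apply Real.sin_pos_of_pos_of_lt_pi (by positivity)
  rw [div_lt_iff₀ (by linarith)]
  nlinarith [Real.pi_pos]

/-- By the double-angle formulas, comparing two constellation points at angular distance `2b`
reduces to the sign of the form vanishing on their bisector. -/
lemma re_sub_re_mul_cis (t : ℂ) (b : ℝ) :
    t.re - (t * cis (2 * b)).re = 2 * Real.sin b * edge b t := by
  rw [edge_def]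
  simp only [Complex.mul_re, cis_re, cis_im, Real.cos_two_mul, Real.sin_two_mul]
  have := Real.sin_sq_add_cos_sq b
  linear_combination (-2 * t.re) * this

namespace IsPSKQuantizer

variable {K : ℕ} {β : ℝ} {Q : ℂ → ℂ}

lemma re_mul_cis_le (h : IsPSKQuantizer K β Q) (x : ℂ) (m : ℤ) :
    (x * star (Q x) * cis (2 * Real.pi / K * m)).re ≤ (x * star (Q x)).re := by
  obtain ⟨⟨k, hk⟩, h2⟩ := h x
  have := h2 (k + (-m))
  rw [pskPt_add, ← hk, star_mul', star_cis, ← mul_assoc] at this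
  convert this using 4
  push_cast; ring

/-- The quantized value deviates from the input by an angle of at most `π / K`. -/
lemma edge_nonneg (h : IsPSKQuantizer K β Q) (hK : 2 ≤ K) (x : ℂ) :
    0 ≤ edge (Real.pi / K) (x * star (Q x)) ∧ 0 ≤ edge (Real.pi / K) (star x * Q x) := by
  have hs := sin_pi_div_pos hK
  -- Comparison with the two neighbours of `Q x` suffices, one for each edge of the cell.
  constructor
  · have h1 := h.re_mul_cis_le x 1
    have h2 := re_sub_re_mul_cis (x * star (Q x)) (Real.pi / K)
    rw [show 2 * Real.pi / K * ((1 : ℤ) : ℝ) = 2 * (Real.pi / K) by push_cast; ring] at h1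
    by_contra hc
    nlinarith
  · have h1 := h.re_mul_cis_le x (-1)
    have h2 := re_sub_re_mul_cis (x * star (Q x)) (-(Real.pi / K))
    rw [show 2 * Real.pi / K * ((-1 : ℤ) : ℝ) = 2 * (-(Real.pi / K)) by push_cast; ring] at h1
    have h3 : edge (-(Real.pi / K)) (x * star (Q x)) = - edge (Real.pi / K) (star x * Q x) := by
      rw [show star x * Q x = star (x * star (Q x)) by simp [mul_comm], edge_star, edge_def,
        Real.sin_neg, Real.cos_neg]
      ring
    rw [h3, Real.sin_neg] at h2
    by_contra hc
    nlinarith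

end IsPSKQuantizer

/-- Inside the open sector of half-angle `π / K` the edge form is positive for every angle
between the two edges. -/
lemma InSector.edge_pos {K : ℕ} {t : ℂ} (ht : InSector K t) (hK : 2 ≤ K) {b : ℝ}
    (hb1 : Real.pi / K ≤ b) (hb2 : b ≤ Real.pi - Real.pi / K) : 0 < edge b t := by
  obtain ⟨h1, h2⟩ := ht
  have hs := sin_pi_div_pos hK
  have hpi := Real.pi_pos
  rw [edge_def] at h1 ⊢
  rw [edge_star] at h2
  set α := Real.pi / K with hα
  have hα0 : 0 < α := by positivity
  -- a positive real part, and sin b cos α ≥ |cos b| sin α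
  have hre : 0 < t.re := by nlinarith
  have e1 : 0 ≤ Real.sin (b - α) :=
    Real.sin_nonneg_of_nonneg_of_le_pi (by linarith) (by linarith)
  have e2 : 0 ≤ Real.sin (b + α) :=
    Real.sin_nonneg_of_nonneg_of_le_pi (by linarith) (by linarith)
  have hsb : 0 < Real.sin b := Real.sin_pos_of_pos_of_lt_pi (by linarith) (by linarith)
  rw [Real.sin_sub] at e1
  rw [Real.sin_add] at e2
  set s := Real.sin α
  set c := Real.cos α
  set S := Real.sin b
  set C := Real.cos b
  -- s * (re S + im C) = S * (re s) + im s C, and S * c ≥ |C| s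
  have hgoal : 0 < s * (t.re * S + t.im * C) := by
    have hA : 0 < t.re * s * S + s * (t.im * C) := by
      have h3 : -(t.im * c) < t.re * s := by linarith
      have h4 : t.im * c < t.re * s := by linarith
      rcases le_total 0 (t.im) with hi | hi
      · nlinarith [mul_nonneg hi e2, mul_lt_mul_of_pos_right h4 hsb]
      · nlinarith [mul_nonneg (neg_nonneg.2 hi) e1, mul_lt_mul_of_pos_right h3 hsb]
    nlinarith
  exact (mul_pos_iff_of_pos_left hs).1 hgoal

/-- A point in the open sector around a constellation point is quantized to it. -/
lemma IsPSKQuantizer.eq_of_inSector {K : ℕ} {β : ℝ} {Q : ℂ → ℂ} (h : IsPSKQuantizer K β Q)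
    (hK : 2 ≤ K) {x : ℂ} {k : ℤ} (ht : InSector K (x * star (pskPt K β k))) :
    Q x = pskPt K β k := by
  obtain ⟨⟨m, hm⟩, h2⟩ := h x
  rw [hm]
  -- `j` counts the steps from the chosen point to the `k`-th one. If `0 < j < K`, the bisector
  -- angle `π j / K` lies in the range of `InSector.edge_pos`, so the `k`-th point is strictly
  -- better than the chosen one.
  set j : ℤ := (k - m) % K with hj
  have hj0 : 0 ≤ j := Int.emod_nonneg _ (by omega)
  have hj1 : j < K := Int.emod_lt_of_pos _ (by omega)
  have hmj : pskPt K β m = pskPt K β (k + (-j)) := by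
    rw [← pskPt_add_mul K (by omega) β m ((k - m) / K)]
    congr 1
    have := Int.emod_add_mul_ediv (k - m) K
    rw [← hj] at this
    linarith
  rcases hj0.eq_or_lt with h0 | h0
  · rw [hmj, ← h0]; simp
  · exfalso
    have hk := h2 k
    rw [hm, hmj, pskPt_add, star_mul', star_cis, ← mul_assoc] at hk
    set t := x * star (pskPt K β k)
    have e : -(2 * Real.pi / K * ((-j : ℤ) : ℝ)) = 2 * (Real.pi / K * j) := by push_cast; ring
    rw [e] at hk
    have hK' : (0 : ℝ) < K := by positivity
    have hj0' : (1 : ℝ) ≤ j := by exact_mod_cast h0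
    have hj1' : (j : ℝ) ≤ K - 1 := by
      have : j ≤ (K : ℤ) - 1 := by omega
      exact_mod_cast this
    have hd : 0 < Real.pi / K := by positivity
    have hdK : Real.pi / K * K = Real.pi := by field_simp
    have hb1 : Real.pi / K ≤ Real.pi / K * j := by nlinarith
    have hb2 : Real.pi / K * j ≤ Real.pi - Real.pi / K := by nlinarith
    have h3 := ht.edge_pos hK hb1 hb2
    have h4 : 0 < Real.sin (Real.pi / K * j) :=
      Real.sin_pos_of_pos_of_lt_pi (by linarith) (by linarith)
    have h5 := re_sub_re_mul_cis t (Real.pi / K * j)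
    nlinarith [mul_pos h4 h3]

/-- `InSector 1` is empty, because `edge π` takes opposite values at `t` and `star t`. The sector
arguments therefore miss the one-point constellation, which is handled here. -/
lemma IsPSKQuantizer.eq_of_card_one {β : ℝ} {Q : ℂ → ℂ} (h : IsPSKQuantizer 1 β Q) (x : ℂ)
    (k : ℤ) : Q x = pskPt 1 β k := by
  obtain ⟨m, hm⟩ := (h x).1
  rw [hm]
  have := pskPt_add_mul 1 le_rfl β k (m - k)
  rw [← this]; congr 1; push_cast; ring

/-! ### Deterministic consequences of a detection error -/

/-- If `K > M`, points of the closed `π / K` sector have a distance to the edges of the `π / M`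
sector that is proportional to their norm. -/
lemma exists_mul_norm_le_edge {K M : ℕ} (hM : 2 ≤ M) (hMK : M < K) :
    ∃ c : ℝ, 0 < c ∧ ∀ t : ℂ, 0 ≤ edge (Real.pi / K) t → 0 ≤ edge (Real.pi / K) (star t) →
      c * ‖t‖ ≤ edge (Real.pi / M) t := by
  have hpi := Real.pi_pos
  have hM' : (2 : ℝ) ≤ M := by exact_mod_cast hM
  have hMK' : (M : ℝ) < K := by exact_mod_cast hMK
  have hm2 : Real.pi / M ≤ Real.pi / 2 := by gcongr
  have hkm : Real.pi / K < Real.pi / M := by gcongr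
  have hK0 : (0 : ℝ) < K := by linarith
  have hk0 : 0 < Real.pi / K := by positivity
  have hs : 0 < Real.sin (Real.pi / K) := sin_pi_div_pos (by omega)
  have hc : 0 < Real.cos (Real.pi / K) := Real.cos_pos_of_mem_Ioo ⟨by linarith, by linarith⟩
  have h1 : 0 < Real.sin (Real.pi / M - Real.pi / K) :=
    Real.sin_pos_of_pos_of_lt_pi (by linarith) (by linarith)
  have h2 : 0 < Real.sin (Real.pi / M + Real.pi / K) :=
    Real.sin_pos_of_pos_of_lt_pi (by linarith) (by linarith)
  rw [Real.sin_sub] at h1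
  rw [Real.sin_add] at h2
  simp only [edge_star]
  simp only [edge_def]
  set s := Real.sin (Real.pi / K)
  set c := Real.cos (Real.pi / K)
  set S := Real.sin (Real.pi / M)
  set C := Real.cos (Real.pi / M)
  set p := S * c - C * s
  set q := S * c + C * s
  -- 2 s c edge_M = p * edge⁻ + q * edge⁺
  set m := min p q
  have hm : 0 < m := lt_min h1 h2
  -- The constant equals `m / (2 (s + c))`. Below, `hle` gives `edge ≥ m Re t / c` and `hnorm` gives
  -- `Re t ≥ c ‖t‖ / (s + c)`; half of the resulting constant is enough.
  refine ⟨m * (s * c) / (2 * s * c * (s + c)), div_pos (mul_pos hm (mul_pos hs hc)) (by positivity), fun t ht1 ht2 => ?_⟩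
  have hid : 2 * s * c * (t.re * S + t.im * C)
      = p * (t.re * s - t.im * c) + q * (t.re * s + t.im * c) := by
    simp only [p, q]; ring
  have hre : 0 ≤ t.re := by nlinarith
  have hle : m * (2 * (t.re * s)) ≤ 2 * s * c * (t.re * S + t.im * C) := by
    rw [hid]
    nlinarith [mul_le_mul_of_nonneg_right (min_le_left p q) ht2,
      mul_le_mul_of_nonneg_right (min_le_right p q) ht1]
  have hnorm : ‖t‖ * c ≤ (s + c) * t.re := by
    have h := Complex.norm_le_abs_re_add_abs_im t
    rw [abs_of_nonneg hre] at h
    have : |t.im| * c ≤ t.re * s := by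
      rw [show |t.im| * c = |t.im * c| by rw [abs_mul, abs_of_pos hc], abs_le]
      constructor <;> linarith
    nlinarith
  rw [div_mul_eq_mul_div, div_le_iff₀ (by positivity)]
  have hsc : 0 < s + c := by positivity
  nlinarith [mul_le_mul_of_nonneg_left hnorm (mul_pos hm hs).le,
    mul_le_mul_of_nonneg_right hle hsc.le, mul_nonneg (mul_nonneg hm.le hre) (mul_pos hs hsc).le]

section DetectionError

variable {N M : ℕ} {K : Fin N → ℕ} {β : Fin N → ℝ} {Q : Fin N → ℂ → ℂ}

/-- A detection error forces one of the edge forms of the combined signal to be dominated by the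
noise. -/
lemma sum_edge_le_of_not_inSector (hQ : ∀ i, IsPSKQuantizer (K i) (β i) (Q i))
    {x w : Fin N → ℂ} (h : ¬ InSector M (∑ i, star (x i) * Q i (x i + w i))) :
    ∑ i, edge (Real.pi / M) (star (x i + w i) * Q i (x i + w i)) ≤ ∑ i, ‖w i‖ ∨
    ∑ i, edge (Real.pi / M) (star (star (x i + w i) * Q i (x i + w i))) ≤ ∑ i, ‖w i‖ := by
  have hn : ∀ i, ‖star (w i) * Q i (x i + w i)‖ = ‖w i‖ := by
    intro i; rw [norm_mul, (hQ i).norm_eq, mul_one, norm_star]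
  -- The combiner uses the noiseless `x`, while the quantizer controls the noisy `x + w`. The
  -- discrepancy has norm exactly `‖w i‖`, as `Q` has unit modulus.
  have hx : ∀ i, star (x i) * Q i (x i + w i)
      = star (x i + w i) * Q i (x i + w i) - star (w i) * Q i (x i + w i) := by
    intro i; rw [star_add]; ring
  rw [InSector, not_and_or, not_lt, not_lt] at h
  refine h.imp (fun h => ?_) (fun h => ?_)
  · rw [edge_sum] at h
    simp only [hx, edge_sub, Finset.sum_sub_distrib] at h
    refine (sub_nonpos.1 h).trans (Finset.sum_le_sum fun i _ => ?_)
    exact (le_abs_self _).trans ((abs_edge_le _ _).trans (hn i).le)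
  · rw [star_sum, edge_sum] at h
    simp only [hx, star_sub, edge_sub, Finset.sum_sub_distrib] at h
    refine (sub_nonpos.1 h).trans (Finset.sum_le_sum fun i _ => ?_)
    exact (le_abs_self _).trans ((abs_edge_le _ _).trans ((norm_star _).le.trans (hn i).le))

/-- With more quantization levels than symbols, an error forces the signal to be dominated by
the noise. -/
lemma exists_norm_le_of_not_inSector {K M N : ℕ} (hM : 2 ≤ M) (hMK : M < K) :
    ∃ C : ℝ, 0 < C ∧ ∀ (β : ℝ) (Q : ℂ → ℂ), IsPSKQuantizer K β Q → ∀ x w : Fin N → ℂ,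
      ¬ InSector M (∑ i, star (x i) * Q (x i + w i)) → ‖x‖ ≤ C * ∑ i, ‖w i‖ := by
  obtain ⟨c, hc, hct⟩ := exists_mul_norm_le_edge hM hMK
  refine ⟨1 / c + 1, by positivity, fun β Q hQ x w h => ?_⟩
  have hT : 0 ≤ ∑ i, ‖w i‖ := Finset.sum_nonneg fun _ _ => norm_nonneg _
  have hyn : ∀ i, ‖star (x i + w i) * Q (x i + w i)‖ = ‖x i + w i‖ := by
    intro i; rw [norm_mul, hQ.norm_eq, mul_one, norm_star]
  have hst : ∀ y, star (star y * Q y) = y * star (Q y) := by intro y; simp [mul_comm]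
  have hE : ∀ y : ℂ, c * ‖star y * Q y‖ ≤ edge (Real.pi / M) (star y * Q y) ∧
      c * ‖star y * Q y‖ ≤ edge (Real.pi / M) (star (star y * Q y)) := by
    intro y
    obtain ⟨h1, h2⟩ := hQ.edge_nonneg (by omega) y
    refine ⟨hct _ h2 (by rwa [hst]), ?_⟩
    rw [← norm_star]
    exact hct _ (by rwa [hst]) (by rwa [star_star])
  -- The summands are nonnegative, so the bound on the sum holds for every antenna. This
  -- simultaneous smallness produces the full diversity order.
  have hy : ∀ i, c * ‖x i + w i‖ ≤ ∑ i, ‖w i‖ := by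
    intro i
    have hnn : ∀ j, 0 ≤ c * ‖star (x j + w j) * Q (x j + w j)‖ := fun j => by positivity
    rw [← hyn]
    rcases sum_edge_le_of_not_inSector (fun _ => hQ) h with h | h
    · refine ((hE _).1.trans ?_).trans h
      exact Finset.single_le_sum (f := fun i => edge (Real.pi / M)
        (star (x i + w i) * Q (x i + w i))) (fun j _ => (hnn j).trans (hE _).1)
        (Finset.mem_univ i)
    · refine ((hE _).2.trans ?_).trans h
      exact Finset.single_le_sum (f := fun i => edge (Real.pi / M)
        (star (star (x i + w i) * Q (x i + w i)))) (fun j _ => (hnn j).trans (hE _).2)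
        (Finset.mem_univ i)
  rw [pi_norm_le_iff_of_nonneg (by positivity)]
  intro i
  have h1 : ‖x i‖ ≤ ‖x i + w i‖ + ‖w i‖ := by
    calc ‖x i‖ = ‖(x i + w i) - w i‖ := by ring_nf
      _ ≤ _ := norm_sub_le _ _
  have h2 : ‖w i‖ ≤ ∑ i, ‖w i‖ :=
    Finset.single_le_sum (f := fun i => ‖w i‖) (fun _ _ => norm_nonneg _) (Finset.mem_univ i)
  have h3 : ‖x i + w i‖ ≤ (1 / c) * ∑ i, ‖w i‖ := by
    rw [one_div, ← div_eq_inv_mul, le_div_iff₀ hc, mul_comm]; exact hy i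
  linarith

/-- A point of the cell around the ray with angle `0` is closest to that ray among the `K` rays. -/
lemma IsPSKQuantizer.abs_im_le {K : ℕ} (hK : Even K) (hK2 : 2 ≤ K) {G : ℂ → ℂ}
    (hG : IsPSKQuantizer K 0 G) {x : ℂ} (hx : G x = 1) (m : ℤ) :
    |x.im| ≤ |(x * cis (2 * Real.pi / K * m)).im| := by
  obtain ⟨k, rfl⟩ := hK
  have hk : (k : ℝ) ≠ 0 := by
    have : 1 ≤ k := by omega
    positivity
  set φ := 2 * Real.pi / ((k + k : ℕ) : ℝ) * m with hφ
  -- For even `K` the antipodal rotation `φ + π` is also available, so `|Re (x e^{iφ})| ≤ Re x`.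
  -- Rotation preserves the modulus, which reverses the inequality for imaginary parts.
  have h1 := hG.re_mul_cis_le x m
  have h2 := hG.re_mul_cis_le x (m + k)
  rw [hx] at h1 h2
  have e : 2 * Real.pi / ((k + k : ℕ) : ℝ) * ((m + k : ℤ) : ℝ) = φ + Real.pi := by
    rw [hφ]; push_cast; field_simp; ring
  rw [e, cis_add, cis_pi] at h2
  rw [← hφ] at h1
  simp only [star_one, mul_one] at h1 h2
  have h3 : -(x * cis φ).re ≤ x.re := by
    convert h2 using 1
    rw [mul_neg, mul_one, mul_neg, Complex.neg_re]
  have h4 : (x * cis φ).re ^ 2 ≤ x.re ^ 2 := by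
    rw [sq_le_sq]
    exact (abs_le.2 ⟨by linarith, h1⟩).trans (le_abs_self _)
  have h5 : (x * cis φ).re ^ 2 + (x * cis φ).im ^ 2 = x.re ^ 2 + x.im ^ 2 := by
    have : Complex.normSq (x * cis φ) = Complex.normSq x := by
      rw [Complex.normSq_eq_norm_sq, Complex.normSq_eq_norm_sq, norm_mul, norm_cis, mul_one]
    simp only [Complex.normSq_apply] at this
    linarith
  exact sq_le_sq.1 (by linarith)

/-- With as many quantization levels as symbols, an error forces each antenna output to be
within the noise of some cell boundary. -/
lemma abs_im_le_of_not_inSector {K N : ℕ} (hK : Even K) (hK2 : 2 ≤ K) {Q G : Fin N → ℂ → ℂ}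
    (hQ : ∀ i, IsPSKQuantizer K (Real.pi / K) (Q i)) (hG : ∀ i, IsPSKQuantizer K 0 (G i))
    {x w : Fin N → ℂ} (hx : ∀ i, G i (x i) = 1)
    (h : ¬ InSector K (∑ i, star (x i) * Q i (x i + w i))) (i : Fin N) :
    |(x i).im| ≤ 2 * ∑ i, ‖w i‖ := by
  have hst : ∀ i y, star (star y * Q i y) = y * star (Q i y) := by intro i y; simp [mul_comm]
  have hnn : ∀ i y, 0 ≤ edge (Real.pi / K) (star y * Q i y) ∧
      0 ≤ edge (Real.pi / K) (star (star y * Q i y)) := by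
    intro i y
    obtain ⟨h1, h2⟩ := (hQ i).edge_nonneg hK2 y
    exact ⟨h2, by rwa [hst]⟩
  -- Up to conjugation, the small edge form is the imaginary part of `y_i` after rotating one edge
  -- of its cell, at angle `2π(k+1)/K` or `2πk/K`, onto the real axis. Passing from `y_i` back to
  -- `x_i` costs another `‖w i‖`, hence the factor `2`.
  have hy : ∃ m : ℤ, |((x i + w i) * cis (2 * Real.pi / K * m)).im| ≤ ∑ i, ‖w i‖ := by
    obtain ⟨k, hk⟩ := (hQ i (x i + w i)).1
    rcases sum_edge_le_of_not_inSector hQ h with h | h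
    · refine ⟨-(k + 1), ?_⟩
      have h1 : edge (Real.pi / K) (star (x i + w i) * Q i (x i + w i)) ≤ _ :=
        (Finset.single_le_sum (f := fun i => edge (Real.pi / K)
          (star (x i + w i) * Q i (x i + w i))) (fun j _ => (hnn j _).1)
          (Finset.mem_univ i)).trans h
      have h0 := (hnn i (x i + w i)).1
      have e : (x i + w i) * cis (2 * Real.pi / K * ((-(k + 1) : ℤ) : ℝ))
          = star ((star (x i + w i) * Q i (x i + w i)) * cis (Real.pi / K)) := by
        rw [hk, pskPt, mul_assoc, ← cis_add, star_mul', star_star, star_cis]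
        congr 2; push_cast; ring
      have e2 : ∀ z : ℂ, |(star z).im| = |z.im| := by intro z; simp
      rw [e, e2]
      unfold edge at h0 h1
      rwa [abs_of_nonneg h0]
    · refine ⟨-k, ?_⟩
      have h1 : edge (Real.pi / K) (star (star (x i + w i) * Q i (x i + w i))) ≤ _ :=
        (Finset.single_le_sum (f := fun i => edge (Real.pi / K)
          (star (star (x i + w i) * Q i (x i + w i)))) (fun j _ => (hnn j _).2)
          (Finset.mem_univ i)).trans h
      have h0 := (hnn i (x i + w i)).2
      have e : (x i + w i) * cis (2 * Real.pi / K * ((-k : ℤ) : ℝ))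
          = (star (star (x i + w i) * Q i (x i + w i))) * cis (Real.pi / K) := by
        rw [hst, hk, pskPt, star_cis, mul_assoc, ← cis_add]
        congr 2; push_cast; ring
      rw [e]
      unfold edge at h0 h1
      rwa [abs_of_nonneg h0]
  obtain ⟨m, hm⟩ := hy
  have h1 := (hG i).abs_im_le hK hK2 (hx i) m
  have h2 : |(x i * cis (2 * Real.pi / K * m)).im|
      ≤ |((x i + w i) * cis (2 * Real.pi / K * m)).im| + ‖w i‖ := by
    have e : (x i * cis (2 * Real.pi / K * m)).im
      = ((x i + w i) * cis (2 * Real.pi / K * m)).im - (w i * cis (2 * Real.pi / K * m)).im := by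
      rw [← Complex.sub_im]; ring_nf
    rw [e]
    refine (abs_sub _ _).trans ?_
    gcongr
    exact (Complex.abs_im_le_norm _).trans (by rw [norm_mul, norm_cis, mul_one])
  have h3 : ‖w i‖ ≤ ∑ i, ‖w i‖ :=
    Finset.single_le_sum (f := fun i => ‖w i‖) (fun _ _ => norm_nonneg _) (Finset.mem_univ i)
  linarith

end DetectionError

/-! ### Densities and scaling limits -/

/-- A finite product of measures with integrable densities has the product density. -/
lemma pi_withDensity_ofReal {ι E : Type*} [Fintype ι] [MeasurableSpace E] (ν : Measure E)
    [SigmaFinite ν] {f : E → ℝ} (hf0 : ∀ x, 0 ≤ f x) (hfi : Integrable f ν) :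
    Measure.pi (fun _ : ι => ν.withDensity fun x => ENNReal.ofReal (f x))
      = (Measure.pi fun _ : ι => ν).withDensity fun x => ENNReal.ofReal (∏ i, f (x i)) := by
  have : IsFiniteMeasure (ν.withDensity fun x => ENNReal.ofReal (f x)) :=
    isFiniteMeasure_withDensity_ofReal hfi.2
  refine (Measure.pi_eq fun s hs => ?_)
  have hind : ∀ i, Integrable ((s i).indicator f) ν := fun i => hfi.indicator (hs i)
  have hind0 : ∀ i x, 0 ≤ (s i).indicator f x := fun i x => Set.indicator_nonneg (fun x _ => hf0 x) x
  rw [withDensity_apply _ (MeasurableSet.univ_pi hs), ← lintegral_indicator (MeasurableSet.univ_pi hs)]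
  have e1 : ∀ x : ι → E, (Set.univ.pi s).indicator (fun x => ENNReal.ofReal (∏ i, f (x i))) x
      = ENNReal.ofReal (∏ i, (s i).indicator f (x i)) := by
    intro x
    by_cases hx : x ∈ Set.univ.pi s
    · rw [Set.indicator_of_mem hx]
      congr 1
      exact Finset.prod_congr rfl fun i _ => (Set.indicator_of_mem (hx i trivial) f).symm
    · rw [Set.indicator_of_notMem hx]
      simp only [Set.mem_univ_pi, not_forall] at hx
      obtain ⟨i, hi⟩ := hx
      rw [Finset.prod_eq_zero (Finset.mem_univ i) (Set.indicator_of_notMem hi f), ENNReal.ofReal_zero]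
  simp_rw [e1]
  rw [← ofReal_integral_eq_lintegral_ofReal (Integrable.fintype_prod hind)
    (Eventually.of_forall fun x => Finset.prod_nonneg fun i _ => hind0 i _),
    integral_fintype_prod_eq_prod, ENNReal.ofReal_prod_of_nonneg
      (fun i _ => integral_nonneg (hind0 i))]
  refine Finset.prod_congr rfl fun i _ => ?_
  rw [withDensity_apply _ (hs i), ← lintegral_indicator (hs i),
    ofReal_integral_eq_lintegral_ofReal (hind i) (Eventually.of_forall (hind0 i))]
  refine lintegral_congr fun x => ?_
  by_cases hx : x ∈ s i <;> simp [hx]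

/-- Scaling limit of probabilities under a density proportional to `exp (-q)` with `q`
homogeneous of degree two. -/
theorem tendsto_rpow_mul_measureReal_scaled {Ω E : Type*} [MeasurableSpace Ω]
    [NormedAddCommGroup E] [NormedSpace ℝ E] [MeasurableSpace E] [BorelSpace E]
    [FiniteDimensional ℝ E] (P : Measure Ω) [IsProbabilityMeasure P] (lam : Measure E)
    [lam.IsAddHaarMeasure] {q : E → ℝ} (hq : Measurable q) (hq0 : ∀ x, 0 ≤ q x)
    (hqs : ∀ (t : ℝ) x, q (t • x) = t ^ 2 * q x) {C : ℝ} (hC : 0 < C)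
    {A : ℝ → Set (Ω × E)} (hA : ∀ ρ, MeasurableSet (A ρ))
    {S : Set (Ω × E)} (hS : (P.prod lam) S ≠ ⊤) (hAS : ∀ ρ, 0 < ρ → A ρ ⊆ S)
    (hlim : ∀ᵐ z ∂(P.prod lam), (∀ᶠ ρ in atTop, z ∈ A ρ) ∨ ∀ᶠ ρ in atTop, z ∉ A ρ)
    {B : Set (Ω × E)} (hB : MeasurableSet B) (hB0 : (P.prod lam) B ≠ 0)
    (hBA : ∀ z ∈ B, ∀ᶠ ρ in atTop, z ∈ A ρ) :
    ∃ c : ℝ, 0 < c ∧ Tendsto (fun ρ : ℝ => ρ ^ ((Module.finrank ℝ E : ℝ) / 2) *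
      (P.prod (lam.withDensity fun x => ENNReal.ofReal (C * Real.exp (-q x)))).real
        {z | (z.1, Real.sqrt ρ • z.2) ∈ A ρ}) atTop (nhds c) := by
  classical
  set d := Module.finrank ℝ E
  -- This is the integrand after the substitution `x ↦ √ρ • x`: homogeneity turns `q x` into `q x /
  -- ρ`, and the Jacobian cancels `ρ ^ (d / 2)`.
  let F : ℝ → Ω × E → ENNReal := fun ρ =>
    (A ρ).indicator fun z => ENNReal.ofReal (C * Real.exp (-(q z.2 / ρ)))
  have hFm : ∀ ρ, Measurable (F ρ) := fun ρ =>
    Measurable.indicator (by fun_prop) (hA ρ)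
  -- The pointwise limit is `C` on the points eventually in `A ρ`. That set need not be shown
  -- measurable: `S` bounds its integral above, and the measurable set `B` bounds it below.
  let Finf : Ω × E → ENNReal := fun z => if ∀ᶠ ρ in atTop, z ∈ A ρ then ENNReal.ofReal C else 0
  have hFle : ∀ ρ, 0 < ρ → ∀ z, F ρ z ≤ S.indicator (fun _ => ENNReal.ofReal C) z := by
    intro ρ hρ z
    by_cases hz : z ∈ A ρ
    · simp only [F, Set.indicator_of_mem hz, Set.indicator_of_mem (hAS ρ hρ hz)]
      apply ENNReal.ofReal_le_ofReal
      have : Real.exp (-(q z.2 / ρ)) ≤ 1 := by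
        rw [Real.exp_le_one_iff]
        have := div_nonneg (hq0 z.2) hρ.le
        linarith
      nlinarith
    · simp [F, Set.indicator_of_notMem hz]
  have hbound : ∫⁻ z, S.indicator (fun _ => ENNReal.ofReal C) z ∂(P.prod lam) ≠ ⊤ :=
    ((lintegral_indicator_const_le S _).trans_lt
      (ENNReal.mul_lt_top ENNReal.ofReal_lt_top hS.lt_top)).ne
  have hFlim : ∀ᵐ z ∂(P.prod lam), Tendsto (fun ρ => F ρ z) atTop (nhds (Finf z)) := by
    filter_upwards [hlim] with z hz
    rcases hz with hz | hz
    · simp only [Finf, if_pos hz]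
      have h1 : Tendsto (fun ρ => ENNReal.ofReal (C * Real.exp (-(q z.2 / ρ)))) atTop
          (nhds (ENNReal.ofReal C)) := by
        apply ENNReal.tendsto_ofReal
        have h2 : Tendsto (fun ρ : ℝ => -(q z.2 / ρ)) atTop (nhds (-0)) :=
          (tendsto_const_nhds.div_atTop tendsto_id).neg
        have h3 := ((Real.continuous_exp.tendsto _).comp h2).const_mul C
        simpa using h3
      refine h1.congr' ?_
      filter_upwards [hz] with ρ hρ
      simp [F, Set.indicator_of_mem hρ]
    · have hz' : ¬ ∀ᶠ ρ in atTop, z ∈ A ρ := fun h => by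
        obtain ⟨ρ, h1, h2⟩ := (h.and hz).exists
        exact h2 h1
      simp only [Finf, if_neg hz']
      refine tendsto_const_nhds.congr' ?_
      filter_upwards [hz] with ρ hρ
      simp [F, Set.indicator_of_notMem hρ]
  have hev : ∀ᶠ ρ : ℝ in atTop, ∀ᵐ z ∂(P.prod lam),
      F ρ z ≤ S.indicator (fun _ => ENNReal.ofReal C) z := by
    filter_upwards [eventually_gt_atTop 0] with ρ hρ using Eventually.of_forall (hFle ρ hρ)
  have hDCT : Tendsto (fun ρ => ∫⁻ z, F ρ z ∂(P.prod lam)) atTop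
      (nhds (∫⁻ z, Finf z ∂(P.prod lam))) :=
    tendsto_lintegral_filter_of_dominated_convergence _ (Eventually.of_forall hFm) hev hbound hFlim
  have hfin : ∫⁻ z, Finf z ∂(P.prod lam) ≠ ⊤ := by
    refine ((lintegral_mono fun z => ?_).trans_lt hbound.lt_top).ne
    by_cases hz : ∀ᶠ ρ in atTop, z ∈ A ρ
    · obtain ⟨ρ, h1, h2⟩ := (hz.and (eventually_gt_atTop 0)).exists
      simp only [Finf, if_pos hz, Set.indicator_of_mem (hAS ρ h2 h1)]; exact le_rfl
    · simp only [Finf, if_neg hz]; exact bot_le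
  have hpos : ∫⁻ z, Finf z ∂(P.prod lam) ≠ 0 := by
    have h1 : ENNReal.ofReal C * (P.prod lam) B ≤ ∫⁻ z, Finf z ∂(P.prod lam) := by
      rw [← lintegral_indicator_const hB]
      refine lintegral_mono fun z => ?_
      by_cases hz : z ∈ B
      · simp only [Finf, if_pos (hBA z hz), Set.indicator_of_mem hz]; exact le_rfl
      · simp [Set.indicator_of_notMem hz]
    intro h0
    rw [h0, nonpos_iff_eq_zero, mul_eq_zero] at h1
    rcases h1 with h1 | h1
    · rw [ENNReal.ofReal_eq_zero] at h1; linarith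
    · exact hB0 h1
  refine ⟨(∫⁻ z, Finf z ∂(P.prod lam)).toReal, ENNReal.toReal_pos hpos hfin, ?_⟩
  refine ((ENNReal.tendsto_toReal hfin).comp hDCT).congr' ?_
  filter_upwards [eventually_gt_atTop 0] with ρ hρ
  have hr : 0 < Real.sqrt ρ := Real.sqrt_pos.2 hρ
  have hT : Measurable fun z : Ω × E => (z.1, Real.sqrt ρ • z.2) := by fun_prop
  have hmap : (P.prod lam).map (fun z : Ω × E => (z.1, Real.sqrt ρ • z.2))
      = ENNReal.ofReal ((Real.sqrt ρ ^ d)⁻¹) • (P.prod lam) := by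
    have h1 := Measure.map_prod_map P lam (measurable_id (α := Ω))
      (measurable_const_smul (Real.sqrt ρ) : Measurable fun x : E => Real.sqrt ρ • x)
    rw [Measure.map_addHaar_smul lam hr.ne', Measure.map_id, Measure.prod_smul_right,
      abs_of_pos (by positivity)] at h1
    exact h1.symm
  have hset : MeasurableSet {z : Ω × E | (z.1, Real.sqrt ρ • z.2) ∈ A ρ} := hT (hA ρ)
  have key : (P.prod (lam.withDensity fun x => ENNReal.ofReal (C * Real.exp (-q x))))
      {z | (z.1, Real.sqrt ρ • z.2) ∈ A ρ}
      = ENNReal.ofReal ((Real.sqrt ρ ^ d)⁻¹) * ∫⁻ z, F ρ z ∂(P.prod lam) := by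
    rw [prod_withDensity_right (by fun_prop), withDensity_apply _ hset,
      ← lintegral_indicator hset, ← smul_eq_mul, ← lintegral_smul_measure, ← hmap, lintegral_map (hFm ρ) hT]
    refine lintegral_congr fun z => ?_
    by_cases hz : (z.1, Real.sqrt ρ • z.2) ∈ A ρ
    · rw [Set.indicator_of_mem (by exact hz)]
      simp only [F, Set.indicator_of_mem hz]
      rw [hqs, Real.sq_sqrt hρ.le, mul_div_cancel_left₀ _ hρ.ne']
    · rw [Set.indicator_of_notMem (by exact hz)]
      simp only [F, Set.indicator_of_notMem hz]
  simp only [Measure.real, key, Function.comp_apply]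
  rw [ENNReal.toReal_mul, ENNReal.toReal_ofReal (by positivity), ← mul_assoc]
  have : ρ ^ ((d : ℝ) / 2) = Real.sqrt ρ ^ d := by
    rw [Real.sqrt_eq_rpow, ← Real.rpow_natCast, ← Real.rpow_mul hρ.le]
    congr 1; ring
  rw [this, mul_inv_cancel₀ (by positivity), one_mul]

/-! ### Gaussian vectors -/

instance isProbabilityMeasure_complexGaussian : IsProbabilityMeasure complexGaussian :=
  Measure.isProbabilityMeasure_map (by
    exact Complex.measurableEquivRealProd.symm.measurable.aemeasurable)

instance isProbabilityMeasure_complexGaussianVec (N : ℕ) :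
    IsProbabilityMeasure (complexGaussianVec N) := by
  unfold complexGaussianVec; infer_instance

/-- The law of `N` independent centred real Gaussians of variance `1 / 2`. -/
noncomputable def realGaussianVec (N : ℕ) : Measure (Fin N → ℝ) :=
  Measure.pi fun _ => gaussianReal 0 (1 / 2)

instance isProbabilityMeasure_realGaussianVec (N : ℕ) :
    IsProbabilityMeasure (realGaussianVec N) := by
  unfold realGaussianVec; infer_instance

lemma gaussianReal_half_eq_withDensity :
    gaussianReal 0 (1 / 2) = volume.withDensity fun x : ℝ =>
      ENNReal.ofReal ((Real.sqrt Real.pi)⁻¹ * Real.exp (-x ^ 2)) := by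
  rw [gaussianReal_of_var_ne_zero _ (by norm_num)]
  congr 1
  ext x
  rw [gaussianPDF, gaussianPDFReal]
  congr 3
  · congr 1; push_cast; ring
  · push_cast; ring

lemma measurePreserving_mk_complexGaussian :
    MeasurePreserving (fun p : ℝ × ℝ => (⟨p.1, p.2⟩ : ℂ))
      ((gaussianReal 0 (1 / 2)).prod (gaussianReal 0 (1 / 2))) complexGaussian :=
  ⟨Complex.measurableEquivRealProd.symm.measurable, rfl⟩

lemma complexGaussian_eq_withDensity :
    complexGaussian = volume.withDensity fun z : ℂ =>
      ENNReal.ofReal (Real.pi⁻¹ * Real.exp (-‖z‖ ^ 2)) := by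
  have hmp : MeasurePreserving (fun p : ℝ × ℝ => (⟨p.1, p.2⟩ : ℂ)) volume volume :=
    Complex.volume_preserving_equiv_real_prod.symm
  refine Measure.ext fun s hs => ?_
  have hs' := measurePreserving_mk_complexGaussian.measurable hs
  have hm : Measurable fun x : ℝ => ENNReal.ofReal ((Real.sqrt Real.pi)⁻¹ * Real.exp (-x ^ 2)) := by
    fun_prop
  rw [withDensity_apply _ hs, ← measurePreserving_mk_complexGaussian.measure_preimage
    hs.nullMeasurableSet, gaussianReal_half_eq_withDensity, prod_withDensity hm hm,
    withDensity_apply _ hs', ← hmp.setLIntegral_comp_preimage hs (by fun_prop),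
    ← Measure.volume_eq_prod]
  refine lintegral_congr fun p => ?_
  rw [← ENNReal.ofReal_mul (by positivity)]
  congr 1
  have h1 : ‖(⟨p.1, p.2⟩ : ℂ)‖ ^ 2 = p.1 ^ 2 + p.2 ^ 2 := by
    rw [← Complex.normSq_eq_norm_sq, Complex.normSq_apply]; ring
  have h2 : (Real.sqrt Real.pi)⁻¹ * (Real.sqrt Real.pi)⁻¹ = Real.pi⁻¹ := by
    rw [← mul_inv, Real.mul_self_sqrt Real.pi_pos.le]
  rw [h1, neg_add, Real.exp_add, ← h2]; ring

lemma realGaussianVec_eq_withDensity (N : ℕ) :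
    realGaussianVec N = volume.withDensity fun x : Fin N → ℝ =>
      ENNReal.ofReal ((Real.sqrt Real.pi)⁻¹ ^ N * Real.exp (-∑ i, x i ^ 2)) := by
  have hfi : Integrable (fun x : ℝ => (Real.sqrt Real.pi)⁻¹ * Real.exp (-x ^ 2)) := by
    have := (integrable_exp_neg_mul_sq (b := 1) one_pos).const_mul (Real.sqrt Real.pi)⁻¹
    simpa using this
  rw [realGaussianVec, gaussianReal_half_eq_withDensity,
    pi_withDensity_ofReal volume (fun x => by positivity) hfi, volume_pi]
  congr 1
  ext x
  rw [Finset.prod_mul_distrib, Finset.prod_const, ← Real.exp_sum, Finset.sum_neg_distrib,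
    Finset.card_univ, Fintype.card_fin]

/-- Read off from the total mass one of `complexGaussian`, without evaluating a planar integral. -/
lemma integrable_complexGaussian_density :
    Integrable fun z : ℂ => Real.pi⁻¹ * Real.exp (-‖z‖ ^ 2) := by
  refine ⟨by fun_prop, ?_⟩
  rw [hasFiniteIntegral_iff_ofReal (Eventually.of_forall fun z => by positivity)]
  have h := congrArg (fun μ => μ Set.univ) complexGaussian_eq_withDensity
  simp only [measure_univ, withDensity_apply _ MeasurableSet.univ, Measure.restrict_univ] at h
  rw [← h]; exact ENNReal.one_lt_top

lemma complexGaussianVec_eq_withDensity (N : ℕ) :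
    complexGaussianVec N = volume.withDensity fun z : Fin N → ℂ =>
      ENNReal.ofReal (Real.pi⁻¹ ^ N * Real.exp (-∑ i, ‖z i‖ ^ 2)) := by
  rw [complexGaussianVec, complexGaussian_eq_withDensity,
    pi_withDensity_ofReal volume (fun x => by positivity) integrable_complexGaussian_density,
    volume_pi]
  congr 1
  ext x
  rw [Finset.prod_mul_distrib, Finset.prod_const, ← Real.exp_sum, Finset.sum_neg_distrib,
    Finset.card_univ, Fintype.card_fin]

lemma complexGaussianVec_absolutelyContinuous (N : ℕ) : complexGaussianVec N ≪ volume := by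
  rw [complexGaussianVec_eq_withDensity]; exact withDensity_absolutelyContinuous _ _

lemma complexGaussian_absolutelyContinuous : complexGaussian ≪ volume := by
  rw [complexGaussian_eq_withDensity]; exact withDensity_absolutelyContinuous _ _

lemma volume_absolutelyContinuous_complexGaussian : volume ≪ complexGaussian := by
  rw [complexGaussian_eq_withDensity]
  refine withDensity_absolutelyContinuous' (by fun_prop) (Eventually.of_forall fun z => ?_)
  rw [Ne, ENNReal.ofReal_eq_zero, not_le]
  have := Real.pi_pos
  positivity

lemma complexGaussian_ne_zero_of_isOpen {U : Set ℂ} (hU : IsOpen U) (hne : U.Nonempty) :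
    complexGaussian U ≠ 0 := fun h =>
  (hU.measure_pos volume hne).ne' (volume_absolutelyContinuous_complexGaussian h)

lemma complexGaussianVec_pi_ne_zero (N : ℕ) {U : Set ℂ} (hU : IsOpen U) (hne : U.Nonempty) :
    complexGaussianVec N (Set.univ.pi fun _ => U) ≠ 0 := by
  rw [complexGaussianVec, Measure.pi_pi]
  exact Finset.prod_ne_zero_iff.2 fun _ _ => complexGaussian_ne_zero_of_isOpen hU hne

/-- Circular symmetry. -/
lemma measurePreserving_cis_mul (θ : ℝ) :
    MeasurePreserving (fun z => cis θ * z) complexGaussian complexGaussian := by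
  have hm : Measurable fun z : ℂ => cis θ * z := by fun_prop
  have hvol : MeasurePreserving (fun z : ℂ => cis θ * z) volume volume := by
    exact (rotation ⟨cis θ, by simp [Submonoid.unitSphere]⟩).measurePreserving
  refine ⟨hm, Measure.ext fun s hs => ?_⟩
  rw [Measure.map_apply hm hs, complexGaussian_eq_withDensity, withDensity_apply _ hs,
    withDensity_apply _ (hm hs), ← hvol.setLIntegral_comp_preimage hs (by fun_prop)]
  refine lintegral_congr fun z => ?_
  rw [norm_mul, norm_cis, one_mul]

lemma measurePreserving_cis_mul_vec {N : ℕ} (θ : Fin N → ℝ) :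
    MeasurePreserving (fun (z : Fin N → ℂ) i => cis (θ i) * z i)
      (complexGaussianVec N) (complexGaussianVec N) :=
  measurePreserving_pi _ _ fun i => measurePreserving_cis_mul (θ i)

/-- The complex vector with given real and imaginary parts. -/
def mkVec {N : ℕ} (a b : Fin N → ℝ) : Fin N → ℂ := fun i => ⟨a i, b i⟩

lemma measurable_mkVec {N : ℕ} :
    Measurable fun p : (Fin N → ℝ) × (Fin N → ℝ) => mkVec p.1 p.2 := by
  refine measurable_pi_lambda _ fun i => ?_
  have h : Measurable fun p : (Fin N → ℝ) × (Fin N → ℝ) => (p.1 i, p.2 i) := by fun_prop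
  exact Complex.measurableEquivRealProd.symm.measurable.comp h

lemma measurePreserving_mkVec (N : ℕ) :
    MeasurePreserving (fun p : (Fin N → ℝ) × (Fin N → ℝ) => mkVec p.1 p.2)
      ((realGaussianVec N).prod (realGaussianVec N)) (complexGaussianVec N) := by
  have h1 : MeasurePreserving (fun (p : Fin N → ℝ × ℝ) i => (⟨(p i).1, (p i).2⟩ : ℂ))
      (Measure.pi fun _ => (gaussianReal 0 (1 / 2)).prod (gaussianReal 0 (1 / 2)))
      (complexGaussianVec N) :=
    measurePreserving_pi _ _ fun _ => measurePreserving_mk_complexGaussian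
  have h2 := (measurePreserving_arrowProdEquivProdArrow ℝ ℝ (Fin N)
    (fun _ => gaussianReal 0 (1 / 2)) (fun _ => gaussianReal 0 (1 / 2))).symm
  exact h1.comp h2

/-- An error confines the rescaled channel to a ball whose radius is proportional to `∑ ‖w i‖`. The
dominating set has finite measure because the noise has moments of every order. -/
lemma integrable_sum_norm_pow (N d : ℕ) :
    Integrable (fun w : Fin N → ℂ => (∑ i, ‖w i‖) ^ d) (complexGaussianVec N) := by
  have h0 : ∀ p : ℝ≥0, MemLp (fun z : ℂ => ‖z‖) p complexGaussian := by
    intro p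
    have h1 : MemLp (fun q : ℝ × ℝ => q.1) p
        ((gaussianReal 0 (1 / 2)).prod (gaussianReal 0 (1 / 2))) :=
      (memLp_id_gaussianReal p).comp_measurePreserving measurePreserving_fst
    have h2 : MemLp (fun q : ℝ × ℝ => q.2) p
        ((gaussianReal 0 (1 / 2)).prod (gaussianReal 0 (1 / 2))) :=
      (memLp_id_gaussianReal p).comp_measurePreserving measurePreserving_snd
    have h3 := h1.norm.add h2.norm
    have h4 : MemLp (fun z : ℂ => |z.re| + |z.im|) p complexGaussian := by
      rw [← measurePreserving_mk_complexGaussian.map_eq, memLp_map_measure_iff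
        (Continuous.aestronglyMeasurable (by fun_prop))
        measurePreserving_mk_complexGaussian.measurable.aemeasurable]
      exact h3
    refine h4.mono (by fun_prop) (Eventually.of_forall fun z => ?_)
    rw [norm_norm]
    exact (Complex.norm_le_abs_re_add_abs_im z).trans (le_abs_self _)
  have h5 : MemLp (fun w : Fin N → ℂ => ∑ i, ‖w i‖) d (complexGaussianVec N) := by
    refine memLp_finsetSum _ fun i _ => ?_
    have := (h0 d).comp_measurePreserving
      (measurePreserving_eval (fun _ : Fin N => complexGaussian) i)
    exact_mod_cast this
  have h6 := h5.integrable_norm_pow'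
  refine h6.congr (Eventually.of_forall fun w => ?_)
  simp only
  rw [Real.norm_of_nonneg (Finset.sum_nonneg fun _ _ => norm_nonneg _)]

/-! ### Reduction to an error event relative to the transmitted symbol -/

/-- The kernel is a proper subspace, hence Haar-null. The ties of the quantizer and of the detector
both lie in such kernels. -/
lemma ae_linearMap_ne_zero {E : Type*} [NormedAddCommGroup E] [NormedSpace ℝ E]
    [MeasurableSpace E] [BorelSpace E] [FiniteDimensional ℝ E] (μ : Measure E)
    [μ.IsAddHaarMeasure] (f : E →ₗ[ℝ] ℝ) {x : E} (hx : f x ≠ 0) : ∀ᵐ y ∂μ, f y ≠ 0 := by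
  have h : LinearMap.ker f ≠ ⊤ := by
    intro h
    exact hx (LinearMap.mem_ker.1 (h ▸ Submodule.mem_top))
  have := Measure.addHaar_submodule μ _ h
  rw [ae_iff]
  convert this using 2
  ext y; simp

lemma edge_I_mul_cis_neg (δ : ℝ) : edge δ (Complex.I * cis (-δ)) = 1 := by
  rw [edge, mul_assoc, ← cis_add]; simp

/-- For a fixed quantized vector the decision statistic is real linear in `h`, so each decision
boundary is the kernel of a linear form. -/
lemma ae_edge_combination_ne_zero {N : ℕ} (hN : 1 ≤ N) (δ : ℝ) {u : ℂ} (hu : u ≠ 0)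
    {r : Fin N → ℂ} (hr : ∀ i, r i ≠ 0) :
    ∀ᵐ h : Fin N → ℂ, edge δ (u * ∑ i, star (h i) * r i) ≠ 0 ∧
      edge δ (star (u * ∑ i, star (h i) * r i)) ≠ 0 := by
  have hadd : ∀ x y : Fin N → ℂ, u * ∑ i, star ((x + y) i) * r i
      = u * ∑ i, star (x i) * r i + u * ∑ i, star (y i) * r i := by
    intro x y
    rw [← mul_add, ← Finset.sum_add_distrib]
    congr 1
    refine Finset.sum_congr rfl fun i _ => ?_
    rw [Pi.add_apply, star_add, add_mul]
  have hsmul : ∀ (c : ℝ) (x : Fin N → ℂ), u * ∑ i, star ((c • x) i) * r i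
      = (c : ℂ) * (u * ∑ i, star (x i) * r i) := by
    intro c x
    rw [mul_left_comm]
    congr 1
    rw [Finset.mul_sum]
    refine Finset.sum_congr rfl fun i _ => ?_
    simp [mul_assoc]
  have hstar : ∀ (c : ℝ) (z : ℂ), star ((c : ℂ) * z) = (c : ℂ) * star z := by intro c z; simp
  let f : (Fin N → ℂ) →ₗ[ℝ] ℝ :=
    { toFun := fun h => edge δ (u * ∑ i, star (h i) * r i)
      map_add' := fun x y => by rw [hadd, edge_add]
      map_smul' := fun c x => by rw [hsmul, edge_ofReal_mul]; rfl }
  let g : (Fin N → ℂ) →ₗ[ℝ] ℝ :=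
    { toFun := fun h => edge δ (star (u * ∑ i, star (h i) * r i))
      map_add' := fun x y => by rw [hadd, star_add, edge_add]
      map_smul' := fun c x => by rw [hsmul, hstar, edge_ofReal_mul]; rfl }
  let i0 : Fin N := ⟨0, hN⟩
  -- One antenna already attains every value `z`, so the forms are nonzero; this is where `1 ≤ N`
  -- enters.
  have hx : ∀ z : ℂ, u * ∑ i, star ((Pi.single i0 (star (z / (u * r i0))) : Fin N → ℂ) i) * r i
      = z := by
    intro z
    rw [Finset.sum_eq_single i0]
    · rw [Pi.single_eq_same, star_star]
      have := hr i0
      field_simp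
    · intro b _ hb; rw [Pi.single_eq_of_ne hb]; simp
    · simp
  have hf := ae_linearMap_ne_zero volume f
    (x := Pi.single i0 (star (Complex.I * cis (-δ) / (u * r i0)))) (by
      change edge δ _ ≠ 0
      rw [hx, edge_I_mul_cis_neg]; exact one_ne_zero)
  have hg := ae_linearMap_ne_zero volume g
    (x := Pi.single i0 (star (star (Complex.I * cis (-δ)) / (u * r i0)))) (by
      change edge δ (star _) ≠ 0
      rw [hx, star_star, edge_I_mul_cis_neg]; exact one_ne_zero)
  filter_upwards [hf, hg] with h h1 h2 using ⟨h1, h2⟩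

lemma star_mul_star_eq (y z : ℂ) : star (y * star z) = star y * z := by simp [mul_comm]

/-- Almost every point lies in the open sector around some constellation point. -/
lemma IsPSKQuantizer.ae_inSector {K : ℕ} {β : ℝ} {Q : ℂ → ℂ} (hQ : IsPSKQuantizer K β Q)
    (hK : 2 ≤ K) : ∀ᵐ y : ℂ, InSector K (y * star (Q y)) := by
  have h : ∀ᵐ y : ℂ, ∀ k : ℤ, edge (Real.pi / K) (y * star (pskPt K β k)) ≠ 0 ∧
      edge (Real.pi / K) (star (y * star (pskPt K β k))) ≠ 0 := by
    rw [ae_all_iff]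
    intro k
    have hlin : ∀ (u : ℂ), u ≠ 0 → ∀ᵐ y : ℂ, edge (Real.pi / K) (y * u) ≠ 0 := by
      intro u hu
      let f : ℂ →ₗ[ℝ] ℝ :=
        { toFun := fun y => edge (Real.pi / K) (y * u)
          map_add' := fun x y => by rw [add_mul, edge_add]
          map_smul' := fun c x => by
            rw [Complex.real_smul, mul_assoc, edge_ofReal_mul]; rfl }
      refine ae_linearMap_ne_zero volume f
        (x := Complex.I * cis (-(Real.pi / K)) / u) ?_
      change edge (Real.pi / K) (_ / u * u) ≠ 0
      rw [div_mul_cancel₀ _ hu, edge_I_mul_cis_neg]; exact one_ne_zero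
    have hlin' : ∀ (u : ℂ), u ≠ 0 → ∀ᵐ y : ℂ, edge (Real.pi / K) (star y * u) ≠ 0 := by
      intro u hu
      let f : ℂ →ₗ[ℝ] ℝ :=
        { toFun := fun y => edge (Real.pi / K) (star y * u)
          map_add' := fun x y => by rw [star_add, add_mul, edge_add]
          map_smul' := fun c x => by
            have : star (c • x) * u = (c : ℂ) * (star x * u) := by simp [mul_assoc]
            rw [this, edge_ofReal_mul]; rfl }
      refine ae_linearMap_ne_zero volume f
        (x := star (Complex.I * cis (-(Real.pi / K)) / u)) ?_
      change edge (Real.pi / K) (star (star (_ / u)) * u) ≠ 0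
      rw [star_star, div_mul_cancel₀ _ hu, edge_I_mul_cis_neg]; exact one_ne_zero
    have h0 : pskPt K β k ≠ 0 := cis_ne_zero _
    filter_upwards [hlin _ (star_ne_zero.2 h0), hlin' _ h0] with y h1 h2
    exact ⟨h1, by rwa [star_mul_star_eq]⟩
  filter_upwards [h] with y hy
  obtain ⟨k, hk⟩ := (hQ y).1
  obtain ⟨h1, h2⟩ := hQ.edge_nonneg hK y
  obtain ⟨h3, h4⟩ := hy k
  rw [← hk] at h3 h4
  refine ⟨lt_of_le_of_ne h1 h3.symm, lt_of_le_of_ne ?_ h4.symm⟩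
  rwa [star_mul_star_eq]

/-- Two quantizers onto the same constellation agree almost everywhere. -/
lemma IsPSKQuantizer.ae_eq {K : ℕ} (hK : 1 ≤ K) {β : ℝ} {Q Q' : ℂ → ℂ}
    (hQ : IsPSKQuantizer K β Q) (hQ' : IsPSKQuantizer K β Q') : ∀ᵐ y : ℂ, Q y = Q' y := by
  rcases hK.eq_or_lt with rfl | hK2
  · refine Eventually.of_forall fun y => ?_
    rw [hQ.eq_of_card_one y 0, hQ'.eq_of_card_one y 0]
  · filter_upwards [hQ.ae_inSector hK2] with y hy
    obtain ⟨k, hk⟩ := (hQ y).1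
    rw [hk] at hy ⊢
    exact (hQ'.eq_of_inSector hK2 hy).symm

/-- The detection error event in the frame rotated by the transmitted symbol. -/
def errorEvent (M N : ℕ) (Q : ℂ → ℂ) (ρ : ℝ) : Set ((Fin N → ℂ) × (Fin N → ℂ)) :=
  {p | ¬ InSector M (∑ i, star (p.1 i) * Q ((Real.sqrt ρ : ℂ) * p.1 i + p.2 i))}

lemma measurableSet_not_inSector (M : ℕ) {α : Type*} [MeasurableSpace α] {f : α → ℂ}
    (hf : Measurable f) : MeasurableSet {x | ¬ InSector M (f x)} :=
  ((isOpen_inSector M).measurableSet.preimage hf).compl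

lemma measurableSet_errorEvent (M N : ℕ) {Q : ℂ → ℂ} (hQ : Measurable Q) (ρ : ℝ) :
    MeasurableSet (errorEvent M N Q ρ) := by
  refine measurableSet_not_inSector M ?_
  refine Finset.measurable_sum _ fun i _ => ?_
  have h1 : Measurable fun p : (Fin N → ℂ) × (Fin N → ℂ) => p.1 i :=
    (measurable_pi_apply i).comp measurable_fst
  have h2 : Measurable fun p : (Fin N → ℂ) × (Fin N → ℂ) => p.2 i :=
    (measurable_pi_apply i).comp measurable_snd
  exact (continuous_star.measurable.comp h1).mul (hQ.comp ((h1.const_mul _).add h2))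

/-- With the first component fixed, the noise makes the received value a translate of a Gaussian, so
it avoids Lebesgue-null sets. The measurable null superset is needed because `p` may be
non-measurable. -/
lemma ae_received_of_ae {N : ℕ} {p : ℂ → Prop} (hp : ∀ᵐ y : ℂ, p y) (i : Fin N)
    {Ω : Type*} [MeasurableSpace Ω] (P : Measure Ω) [SFinite P] {f : Ω → ℂ} (hf : Measurable f) :
    ∀ᵐ z ∂(P.prod (complexGaussianVec N)), p (f z.1 + z.2 i) := by
  obtain ⟨T, hT1, hT2, hT3⟩ := exists_measurable_superset_of_null (ae_iff.1 hp)
  have hm : Measurable fun z : Ω × (Fin N → ℂ) => f z.1 + z.2 i :=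
    (hf.comp measurable_fst).add ((measurable_pi_apply i).comp measurable_snd)
  have h0 : (P.prod (complexGaussianVec N)) {z | f z.1 + z.2 i ∈ T} = 0 := by
    change (P.prod (complexGaussianVec N)) ((fun z => f z.1 + z.2 i) ⁻¹' T) = 0
    rw [Measure.measure_prod_null (hm hT2)]
    refine Eventually.of_forall fun ω => ?_
    have h1 : complexGaussian ((fun z => f ω + z) ⁻¹' T) = 0 := by
      refine complexGaussian_absolutelyContinuous ?_
      rw [measure_preimage_add]; exact hT3
    have h2 := (measurePreserving_eval (fun _ : Fin N => complexGaussian) i).measure_preimage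
      ((measurable_const_add (f ω)) hT2).nullMeasurableSet
    rw [h1] at h2
    exact h2
  rw [ae_iff]
  exact measure_mono_null (fun z hz => hT1 hz) h0

/-- The quantized vector depends on `h`, but there are only countably many index choices, so the
null sets for fixed vectors can be united. -/
lemma ae_inSector_of_quantized {M N K : ℕ} (hN : 1 ≤ N) (β : ℝ) :
    ∀ᵐ h : Fin N → ℂ, ∀ (m : ℤ) (k : Fin N → ℤ),
      edge (Real.pi / M) (star (pskPt M (Real.pi / 4) m) * ∑ i, star (h i) * pskPt K β (k i)) ≠ 0 ∧
      edge (Real.pi / M)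
        (star (star (pskPt M (Real.pi / 4) m) * ∑ i, star (h i) * pskPt K β (k i))) ≠ 0 := by
  rw [ae_all_iff]; intro m
  rw [ae_all_iff]; intro k
  exact ae_edge_combination_ne_zero hN _ (star_ne_zero.2 (cis_ne_zero _))
    (fun i => cis_ne_zero _)

/-- Almost surely `Q` and `Q'` agree and the statistic is off the decision boundaries, so an error
means leaving the open sector around `s`. Replacing `h` by `s h` preserves its law and absorbs the
symbol, so every symbol has the same conditional error probability. -/
theorem averageSEP_eq {K M N : ℕ} (hK : 1 ≤ K) (hM : 2 ≤ M) (hN : 1 ≤ N) {Q Q' D : ℂ → ℂ}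
    (hQ : IsPSKQuantizer K (Real.pi / 4) Q) (hQ' : IsPSKQuantizer K (Real.pi / 4) Q')
    (hQm : Measurable Q') (hD : IsPSKQuantizer M (Real.pi / 4) D) (ρ : ℝ) :
    averageSEP M N Q D ρ
      = ((complexGaussianVec N).prod (complexGaussianVec N)).real (errorEvent M N Q' ρ) := by
  have hpsk := psk_eq_range M (by omega)
  have hfin : (psk M).Finite := hpsk ▸ finite_range_pskPt M (by omega) _
  have hne : (psk M).Nonempty := hpsk ▸ Set.range_nonempty _
  have : IsProbabilityMeasure (uniformOn (psk M)) := isProbabilityMeasure_uniformOn hfin hne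
  have hprob : IsProbabilityMeasure ((complexGaussianVec N).prod (complexGaussianVec N)) :=
    inferInstance
  set ν := (complexGaussianVec N).prod (complexGaussianVec N)
  let A' : Set (ℂ × (Fin N → ℂ) × (Fin N → ℂ)) := {ω | ¬ InSector M
    (star ω.1 * ∑ i, star (ω.2.1 i) * Q' ((Real.sqrt ρ : ℂ) * ω.2.1 i * ω.1 + ω.2.2 i))}
  have hA'm : MeasurableSet A' := by
    refine measurableSet_not_inSector M ?_
    refine (continuous_star.measurable.comp measurable_fst).mul
      (Finset.measurable_sum _ fun i _ => ?_)
    have h1 : Measurable fun p : ℂ × (Fin N → ℂ) × (Fin N → ℂ) => p.2.1 i :=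
      (measurable_pi_apply i).comp (measurable_fst.comp measurable_snd)
    have h2 : Measurable fun p : ℂ × (Fin N → ℂ) × (Fin N → ℂ) => p.2.2 i :=
      (measurable_pi_apply i).comp (measurable_snd.comp measurable_snd)
    exact (continuous_star.measurable.comp h1).mul
      (hQm.comp (((h1.const_mul _).mul measurable_fst).add h2))
  have hs : ∀ᵐ ω ∂(simoLaw M N), ω.1 ∈ psk M :=
    Measure.quasiMeasurePreserving_fst.ae (ae_cond_mem hfin.measurableSet)
  have hq : ∀ᵐ ω ∂(simoLaw M N), ∀ i, Q ((Real.sqrt ρ : ℂ) * ω.2.1 i * ω.1 + ω.2.2 i)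
      = Q' ((Real.sqrt ρ : ℂ) * ω.2.1 i * ω.1 + ω.2.2 i) := by
    rw [ae_all_iff]
    intro i
    have h1 := ae_received_of_ae (hQ.ae_eq hK hQ') i
      ((uniformOn (psk M)).prod (complexGaussianVec N))
      (f := fun z => (Real.sqrt ρ : ℂ) * z.2 i * z.1)
      ((((measurable_pi_apply i).comp measurable_snd).const_mul _).mul measurable_fst)
    exact (measurePreserving_prodAssoc (uniformOn (psk M)) (complexGaussianVec N)
      (complexGaussianVec N)).symm.quasiMeasurePreserving.ae h1
  have hb : ∀ᵐ ω ∂(simoLaw M N), ∀ (m : ℤ) (k : Fin N → ℤ),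
      edge (Real.pi / M) (star (pskPt M (Real.pi / 4) m) *
        ∑ i, star (ω.2.1 i) * pskPt K (Real.pi / 4) (k i)) ≠ 0 ∧
      edge (Real.pi / M) (star (star (pskPt M (Real.pi / 4) m) *
        ∑ i, star (ω.2.1 i) * pskPt K (Real.pi / 4) (k i))) ≠ 0 :=
    Measure.quasiMeasurePreserving_snd.ae (Measure.quasiMeasurePreserving_fst.ae
      ((complexGaussianVec_absolutelyContinuous N).ae_le
        (ae_inSector_of_quantized hN (Real.pi / 4))))
  have hAA' : {ω : ℂ × (Fin N → ℂ) × (Fin N → ℂ) |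
      mrcDetect Q D ω.2.1 (receivedSignal ρ ω.1 ω.2.1 ω.2.2) ≠ ω.1} =ᵐ[simoLaw M N] A' := by
    filter_upwards [hs, hq, hb] with ω h1 h2 h3
    rw [hpsk] at h1
    obtain ⟨m, hm⟩ := h1
    choose k hk using fun i => (hQ' ((Real.sqrt ρ : ℂ) * ω.2.1 i * ω.1 + ω.2.2 i)).1
    have h4 := h3 m k
    have hZ : star ω.2.1 ⬝ᵥ (fun i => Q (receivedSignal ρ ω.1 ω.2.1 ω.2.2 i))
        = ∑ i, star (ω.2.1 i) * Q' ((Real.sqrt ρ : ℂ) * ω.2.1 i * ω.1 + ω.2.2 i) := by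
      simp only [dotProduct, receivedSignal, Pi.star_apply, h2]
    simp only [← hk, hm] at h4
    refine propext (not_congr ?_)
    change D _ = ω.1 ↔ InSector M _
    rw [hZ]
    set Z := ∑ i, star (ω.2.1 i) * Q' ((Real.sqrt ρ : ℂ) * ω.2.1 i * ω.1 + ω.2.2 i)
    constructor
    -- A correct decision yields only the closed sector; `h4` makes the inequalities strict.
    · intro h
      obtain ⟨h5, h6⟩ := hD.edge_nonneg hM Z
      rw [← star_mul_star_eq, h] at h6
      rw [h] at h5
      rw [mul_comm] at h5 h6
      exact ⟨lt_of_le_of_ne h5 h4.1.symm, lt_of_le_of_ne h6 h4.2.symm⟩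
    · intro h
      rw [mul_comm, ← hm] at h
      rw [hD.eq_of_inSector hM h, hm]
  have hslice : ∀ s ∈ psk M, ν (Prod.mk s ⁻¹' A') = ν (errorEvent M N Q' ρ) := by
    intro s hs
    rw [hpsk] at hs
    obtain ⟨m, rfl⟩ := hs
    have hmp : MeasurePreserving (Prod.map
        (fun (z : Fin N → ℂ) i => pskPt M (Real.pi / 4) m * z i) id) ν ν :=
      (measurePreserving_cis_mul_vec fun _ => _).prod (MeasurePreserving.id _)
    rw [← hmp.measure_preimage (measurableSet_errorEvent M N hQm ρ).nullMeasurableSet]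
    congr 1
    ext p
    refine not_congr ?_
    simp only [Prod.map_fst, Prod.map_snd, id]
    rw [Finset.mul_sum]
    refine iff_of_eq (congrArg _ (Finset.sum_congr rfl fun i _ => ?_))
    rw [star_mul', mul_assoc, mul_assoc, mul_comm (p.1 i)]
  rw [averageSEP, Measure.real, measure_congr hAA', Measure.real]
  congr 1
  change ((uniformOn (psk M)).prod ν) A' = _
  have hsf : SFinite ν := @instSFiniteOfSigmaFinite _ _ _ (IsFiniteMeasure.toSigmaFinite ν)
  rw [Measure.prod_apply hA'm]
  rw [lintegral_congr_ae (g := fun _ => ν (errorEvent M N Q' ρ))]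
  · simp
  · filter_upwards [ae_cond_mem (μ := Measure.count) hfin.measurableSet] with s hs
    exact hslice s hs

/-! ### More symbols than quantization levels: an error floor -/

/-- The sector is an open cone: after division by `√ρ` the noise term tends to zero. -/
lemma InSector.eventually_sqrt_mul_add {K : ℕ} {v p : ℂ} (h : InSector K (v * p)) (w : ℂ) :
    ∀ᶠ ρ : ℝ in atTop, InSector K (((Real.sqrt ρ : ℂ) * v + w) * p) := by
  have h1 : Tendsto (fun ρ : ℝ => v * p + (((Real.sqrt ρ)⁻¹ : ℝ) : ℂ) * (w * p)) atTop
      (nhds (v * p)) := by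
    have h2 : Tendsto (fun ρ : ℝ => (((Real.sqrt ρ)⁻¹ : ℝ) : ℂ)) atTop (nhds ((0 : ℝ) : ℂ)) :=
      (Complex.continuous_ofReal.tendsto 0).comp (tendsto_inv_atTop_zero.comp Real.tendsto_sqrt_atTop)
    have h3 := (h2.mul_const (w * p)).const_add (v * p)
    simpa using h3
  filter_upwards [h1.eventually ((isOpen_inSector K).mem_nhds h), eventually_gt_atTop 0]
    with ρ h4 h5
  have hr : 0 < Real.sqrt ρ := Real.sqrt_pos.2 h5
  have h4' : InSector K (v * p + (((Real.sqrt ρ)⁻¹ : ℝ) : ℂ) * (w * p)) := h4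
  rw [← InSector.ofReal_mul hr] at h4'
  convert h4' using 1
  have : (Real.sqrt ρ : ℂ) ≠ 0 := by exact_mod_cast hr.ne'
  push_cast
  field_simp

lemma IsPSKQuantizer.ae_eventually_eq {K : ℕ} (hK : 1 ≤ K) {β : ℝ} {Q : ℂ → ℂ}
    (hQ : IsPSKQuantizer K β Q) :
    ∀ᵐ v : ℂ, ∀ w : ℂ, ∀ᶠ ρ : ℝ in atTop, Q ((Real.sqrt ρ : ℂ) * v + w) = Q v := by
  rcases hK.eq_or_lt with rfl | hK2
  · refine Eventually.of_forall fun v w => Eventually.of_forall fun ρ => ?_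
    rw [hQ.eq_of_card_one _ 0, hQ.eq_of_card_one v 0]
  · filter_upwards [hQ.ae_inSector hK2] with v hv w
    obtain ⟨k, hk⟩ := (hQ v).1
    rw [hk] at hv ⊢
    filter_upwards [hv.eventually_sqrt_mul_add w] with ρ hρ using hQ.eq_of_inSector hK2 hρ

lemma edge_cis (δ a : ℝ) : edge δ (cis a) = Real.sin (a + δ) := by
  rw [edge, ← cis_add, cis_im]

/-- With fewer levels than symbols there is an open cone on which quantization alone moves the
phase out of the decision sector. -/
lemma IsPSKQuantizer.exists_isOpen_edge_neg {K M : ℕ} (hK : 1 ≤ K) (hKM : K < M) {β : ℝ}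
    {Q : ℂ → ℂ} (hQ : IsPSKQuantizer K β Q) :
    ∃ U : Set ℂ, IsOpen U ∧ U.Nonempty ∧ ∀ v ∈ U, edge (Real.pi / M) (v * star (Q v)) < 0 := by
  have hpi := Real.pi_pos
  have hK0 : (1 : ℝ) ≤ K := by exact_mod_cast hK
  have hKM' : (K : ℝ) < M := by exact_mod_cast hKM
  have hmk : Real.pi / M < Real.pi / K := by gcongr
  have hm0 : 0 < Real.pi / M := by have : (0 : ℝ) < M := by linarith
                                   positivity
  have hk1 : Real.pi / K ≤ Real.pi := div_le_self hpi.le hK0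
  set c := pskPt K β 0 with hc
  -- The direction `-θ` relative to `c` lies between the two half-angles: inside the cell of `c`,
  -- but outside the decision sector.
  set θ := (Real.pi / K + Real.pi / M) / 2 with hθ
  have hmulc : cis (-θ) * c * star c = cis (-θ) := by
    rw [mul_assoc, hc, pskPt, cis_mul_star, mul_one]
  have hneg : edge (Real.pi / M) (cis (-θ) * c * star c) < 0 := by
    rw [hmulc, edge_cis]
    exact Real.sin_neg_of_neg_of_neg_pi_lt (by linarith) (by linarith)
  have hopen : IsOpen {v : ℂ | edge (Real.pi / M) (v * star c) < 0} :=
    isOpen_lt ((continuous_edge _).comp (by fun_prop)) continuous_const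
  rcases hK.eq_or_lt with rfl | hK2
  · exact ⟨_, hopen, ⟨_, hneg⟩, fun v hv => by rwa [hQ.eq_of_card_one v 0]⟩
  · have hk2 : Real.pi / K ≤ Real.pi / 2 := by
      have : (2 : ℝ) ≤ K := by exact_mod_cast hK2
      gcongr
    refine ⟨{v : ℂ | edge (Real.pi / M) (v * star c) < 0} ∩ {v | InSector K (v * star c)},
      hopen.inter ((isOpen_inSector K).preimage (by fun_prop)), ⟨_, hneg, ?_⟩, fun v hv => ?_⟩
    · change InSector K _
      rw [hmulc]
      refine ⟨?_, ?_⟩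
      · rw [edge_cis]
        exact Real.sin_pos_of_pos_of_lt_pi (by linarith) (by linarith)
      · rw [star_cis, edge_cis]
        exact Real.sin_pos_of_pos_of_lt_pi (by linarith) (by linarith)
    · rw [hQ.eq_of_inSector hK2 hv.2]; exact hv.1

/-- Antennas that all err towards the same edge cannot compensate one another, by additivity of the
form. -/
lemma not_inSector_of_edge_star_nonpos {M N : ℕ} {z : Fin N → ℂ}
    (h : ∀ i, edge (Real.pi / M) (star (z i)) ≤ 0) : ¬ InSector M (∑ i, z i) := by
  intro hs
  have := hs.2
  rw [star_sum, edge_sum] at this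
  exact absurd this (not_lt.2 (Finset.sum_nonpos fun i _ => h i))

/-- Almost surely `Q (√ρ h + w)` eventually equals `Q h` on each antenna, so the indicators converge
to that of an event in `h` alone. -/
theorem tendsto_error_floor {K M N : ℕ} (hK : 1 ≤ K) (hKM : K < M) {β : ℝ} {Q : ℂ → ℂ}
    (hQ : IsPSKQuantizer K β Q) (hQm : Measurable Q) :
    ∃ c : ℝ, 0 < c ∧ Tendsto (fun ρ : ℝ =>
      ((complexGaussianVec N).prod (complexGaussianVec N)).real (errorEvent M N Q ρ))
      atTop (nhds c) := by
  set ν := (complexGaussianVec N).prod (complexGaussianVec N)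
  let A : Set (Fin N → ℂ) := {v | ¬ InSector M (∑ i, star (v i) * Q (v i))}
  have hA : MeasurableSet A := by
    refine measurableSet_not_inSector M (Finset.measurable_sum _ fun i _ => ?_)
    have h1 : Measurable fun v : Fin N → ℂ => v i := measurable_pi_apply i
    exact (continuous_star.measurable.comp h1).mul (hQm.comp h1)
  have hae : ∀ᵐ z ∂ν, ∀ i, ∀ w : ℂ,
      ∀ᶠ ρ : ℝ in atTop, Q ((Real.sqrt ρ : ℂ) * z.1 i + w) = Q (z.1 i) := by
    rw [ae_all_iff]
    intro i
    refine Measure.quasiMeasurePreserving_fst.ae (p := fun v : Fin N → ℂ => ∀ w : ℂ,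
      ∀ᶠ ρ : ℝ in atTop, Q ((Real.sqrt ρ : ℂ) * v i + w) = Q (v i)) ?_
    exact (measurePreserving_eval (fun _ : Fin N => complexGaussian) i).quasiMeasurePreserving.ae
      (complexGaussian_absolutelyContinuous.ae_le (hQ.ae_eventually_eq hK))
  have hAm : MeasurableSet (Prod.fst ⁻¹' A : Set ((Fin N → ℂ) × (Fin N → ℂ))) :=
    measurable_fst hA
  have hlim : Tendsto (fun ρ : ℝ => ν (errorEvent M N Q ρ)) atTop (nhds (ν (Prod.fst ⁻¹' A))) := by
    refine tendsto_measure_of_ae_tendsto_indicator_of_isFiniteMeasure atTop hAm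
      (measurableSet_errorEvent M N hQm) ?_
    filter_upwards [hae] with z hz
    have h1 : ∀ᶠ ρ : ℝ in atTop, ∀ i, Q ((Real.sqrt ρ : ℂ) * z.1 i + z.2 i) = Q (z.1 i) :=
      eventually_all.2 fun i => hz i (z.2 i)
    filter_upwards [h1] with ρ hρ
    change ¬ InSector M _ ↔ ¬ InSector M _
    simp only [hρ]
  have hpos : ν (Prod.fst ⁻¹' A) ≠ 0 := by
    rw [measurePreserving_fst.measure_preimage hA.nullMeasurableSet]
    obtain ⟨U, hU, hne, hUe⟩ := hQ.exists_isOpen_edge_neg hK hKM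
    refine fun h => complexGaussianVec_pi_ne_zero N hU hne (measure_mono_null (fun v hv => ?_) h)
    refine not_inSector_of_edge_star_nonpos fun i => ?_
    rw [← star_mul_star_eq, star_star]
    exact (hUe _ (hv i trivial)).le
  exact ⟨(ν (Prod.fst ⁻¹' A)).toReal, ENNReal.toReal_pos hpos (measure_ne_top _ _),
    (ENNReal.tendsto_toReal (measure_ne_top _ _)).comp hlim⟩

/-! ### More quantization levels than symbols: full diversity -/

/-- The fibre over `ω` is a ball of radius `T ω`, with volume a constant times `T ω ^ d`. -/
lemma prod_closedBall_ne_top {Ω E : Type*} [MeasurableSpace Ω] [NormedAddCommGroup E]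
    [NormedSpace ℝ E] [MeasurableSpace E] [BorelSpace E] [FiniteDimensional ℝ E]
    (P : Measure Ω) (lam : Measure E) [lam.IsAddHaarMeasure] {T : Ω → ℝ} (hTm : Measurable T)
    (hT : ∀ ω, 0 ≤ T ω) (hint : Integrable (fun ω => T ω ^ Module.finrank ℝ E) P) :
    (P.prod lam) {z | ‖z.2‖ ≤ T z.1} ≠ ⊤ := by
  have hm : MeasurableSet {z : Ω × E | ‖z.2‖ ≤ T z.1} :=
    measurableSet_le measurable_snd.norm (hTm.comp measurable_fst)
  rw [Measure.prod_apply hm]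
  have h1 : ∀ ω, lam (Prod.mk ω ⁻¹' {z : Ω × E | ‖z.2‖ ≤ T z.1})
      = ENNReal.ofReal (T ω ^ Module.finrank ℝ E) * lam (Metric.ball 0 1) := by
    intro ω
    rw [← Measure.addHaar_closedBall lam 0 (hT ω)]
    congr 1
    ext x; simp
  simp_rw [h1]
  rw [lintegral_mul_const _ (by fun_prop),
    ← ofReal_integral_eq_lintegral_ofReal hint (Eventually.of_forall fun ω => by
      have := hT ω
      positivity)]
  exact ENNReal.mul_ne_top ENNReal.ofReal_ne_top (Metric.isBounded_ball.measure_lt_top).ne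

lemma inSector_of_norm_sub_one_lt {K : ℕ} {t : ℂ} (h : ‖t - 1‖ < Real.sin (Real.pi / K)) :
    InSector K t := by
  have key : ∀ t : ℂ, ‖t - 1‖ < Real.sin (Real.pi / K) → 0 < edge (Real.pi / K) t := by
    intro t h
    have h1 := (abs_le.1 (abs_edge_le (Real.pi / K) (t - 1))).1
    have h2 : edge (Real.pi / K) 1 = Real.sin (Real.pi / K) := by rw [edge_def]; simp
    rw [edge_sub, h2] at h1
    linarith
  refine ⟨key t h, key _ ?_⟩
  rwa [← star_one, ← star_sub, norm_star]

/-- Since the sector is a cone, the error event expressed in `x = √ρ h` and `w` does not depend on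
`ρ`. All `2N` real channel coordinates are rescaled, giving exponent `N`. -/
theorem tendsto_full_diversity {K M N : ℕ} (hM : 2 ≤ M) (hMK : M < K) {β : ℝ}
    {Q : ℂ → ℂ} (hQ : IsPSKQuantizer K β Q) (hQm : Measurable Q) :
    ∃ c : ℝ, 0 < c ∧ Tendsto (fun ρ : ℝ => ρ ^ (N : ℝ) *
      ((complexGaussianVec N).prod (complexGaussianVec N)).real (errorEvent M N Q ρ))
      atTop (nhds c) := by
  obtain ⟨C, hC, hCb⟩ := exists_norm_le_of_not_inSector (N := N) hM hMK
  let A : Set ((Fin N → ℂ) × (Fin N → ℂ)) :=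
    {z | ¬ InSector M (∑ i, star (z.2 i) * Q (z.2 i + z.1 i))}
  have hA : MeasurableSet A := by
    refine measurableSet_not_inSector M (Finset.measurable_sum _ fun i _ => ?_)
    have h1 : Measurable fun p : (Fin N → ℂ) × (Fin N → ℂ) => p.1 i :=
      (measurable_pi_apply i).comp measurable_fst
    have h2 : Measurable fun p : (Fin N → ℂ) × (Fin N → ℂ) => p.2 i :=
      (measurable_pi_apply i).comp measurable_snd
    exact (continuous_star.measurable.comp h2).mul (hQm.comp (h2.add h1))
  have hTm : Measurable fun w : Fin N → ℂ => C * ∑ i, ‖w i‖ := by fun_prop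
  have hT0 : ∀ w : Fin N → ℂ, 0 ≤ C * ∑ i, ‖w i‖ := fun w =>
    mul_nonneg hC.le (Finset.sum_nonneg fun _ _ => norm_nonneg _)
  have hS := prod_closedBall_ne_top (E := Fin N → ℂ) (complexGaussianVec N) volume hTm hT0 (by
    simp_rw [mul_pow]
    exact (integrable_sum_norm_pow N _).const_mul _)
  set s := min (Real.sin (Real.pi / K)) (Real.sin (Real.pi / M)) with hs
  have hs0 : 0 < s := lt_min (sin_pi_div_pos (by omega)) (sin_pi_div_pos hM)
  set c := pskPt K β 0 with hc
  have hc1 : c * star c = 1 := cis_mul_star _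
  have hcn : ‖c‖ = 1 := norm_pskPt _ _ _
  -- Noise near `2c` against signal near `-c` puts each output near `c`, opposite to the signal,
  -- which makes an error certain.
  let B : Set ((Fin N → ℂ) × (Fin N → ℂ)) :=
    (Set.univ.pi fun _ => Metric.ball (2 * c) (s / 2)) ×ˢ
      (Set.univ.pi fun _ => Metric.ball (-c) (s / 2))
  have hB : MeasurableSet B :=
    (MeasurableSet.univ_pi fun _ => measurableSet_ball).prod
      (MeasurableSet.univ_pi fun _ => measurableSet_ball)
  have hB0 : ((complexGaussianVec N).prod (volume : Measure (Fin N → ℂ))) B ≠ 0 := by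
    rw [Measure.prod_prod]
    refine mul_ne_zero (complexGaussianVec_pi_ne_zero N Metric.isOpen_ball
      (Metric.nonempty_ball.2 (by linarith))) fun h => ?_
    exact complexGaussianVec_pi_ne_zero N (U := Metric.ball (-c) (s / 2)) Metric.isOpen_ball
      (Metric.nonempty_ball.2 (by linarith)) (complexGaussianVec_absolutelyContinuous N h)
  have hBA : B ⊆ A := by
    rintro ⟨w, x⟩ ⟨hw, hx⟩
    refine not_inSector_of_edge_star_nonpos fun i => ?_
    have hwi : ‖w i - 2 * c‖ < s / 2 := by simpa [dist_eq_norm] using hw i trivial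
    have hxi : ‖x i + c‖ < s / 2 := by simpa [dist_eq_norm] using hx i trivial
    have hQx : Q (x i + w i) = c := by
      refine hQ.eq_of_inSector (by omega) (inSector_of_norm_sub_one_lt ?_)
      calc ‖(x i + w i) * star c - 1‖ = ‖((x i + c) + (w i - 2 * c)) * star c‖ := by
            congr 1; linear_combination hc1
        _ = ‖(x i + c) + (w i - 2 * c)‖ := by rw [norm_mul, norm_star, hcn, mul_one]
        _ < s := (norm_add_le _ _).trans_lt (by linarith)
        _ ≤ _ := min_le_left _ _
    simp only
    rw [hQx, ← star_mul_star_eq, star_star]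
    have h1 : ‖x i * star c + 1‖ < Real.sin (Real.pi / M) := by
      calc ‖x i * star c + 1‖ = ‖(x i + c) * star c‖ := by
            congr 1; linear_combination -hc1
        _ = ‖x i + c‖ := by rw [norm_mul, norm_star, hcn, mul_one]
        _ < s := by linarith
        _ ≤ _ := min_le_right _ _
    have h2 := (abs_le.1 (abs_edge_le (Real.pi / M) (x i * star c + 1))).2
    have h3 : edge (Real.pi / M) 1 = Real.sin (Real.pi / M) := by rw [edge_def]; simp
    rw [edge_add, h3] at h2
    linarith
  obtain ⟨k, hk, hlim⟩ := tendsto_rpow_mul_measureReal_scaled (complexGaussianVec N)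
    (volume : Measure (Fin N → ℂ)) (q := fun z => ∑ i, ‖z i‖ ^ 2) (by fun_prop)
    (fun z => Finset.sum_nonneg fun i _ => by positivity)
    (fun t z => by
      rw [Finset.mul_sum]
      refine Finset.sum_congr rfl fun i _ => ?_
      rw [Pi.smul_apply, norm_smul, mul_pow, Real.norm_eq_abs, sq_abs])
    (C := Real.pi⁻¹ ^ N) (by have := Real.pi_pos; positivity)
    (A := fun _ => A) (fun _ => hA) hS (fun _ _ z hz => hCb β Q hQ _ _ hz)
    (Eventually.of_forall fun z => by
      by_cases hz : z ∈ A
      · exact Or.inl (Eventually.of_forall fun _ => hz)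
      · exact Or.inr (Eventually.of_forall fun _ => hz))
    hB hB0 (fun z hz => Eventually.of_forall fun _ => hBA hz)
  refine ⟨k, hk, hlim.congr' ?_⟩
  filter_upwards [eventually_gt_atTop 0] with ρ hρ
  have hr : 0 < Real.sqrt ρ := Real.sqrt_pos.2 hρ
  have hd : (Module.finrank ℝ (Fin N → ℂ) : ℝ) / 2 = N := by
    rw [Module.finrank_pi_fintype]
    simp [Complex.finrank_real_complex]
  rw [← complexGaussianVec_eq_withDensity, hd]
  congr 1
  have hsw := (Measure.measurePreserving_swap (μ := complexGaussianVec N)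
    (ν := complexGaussianVec N)).measure_preimage
      (measurableSet_errorEvent M N hQm ρ).nullMeasurableSet
  rw [Measure.real, Measure.real, ← hsw]
  congr 2
  ext z
  refine not_congr ?_
  rw [← InSector.ofReal_mul hr (t := ∑ i, star (z.swap.1 i) * _), Finset.mul_sum]
  refine iff_of_eq (congrArg _ (Finset.sum_congr rfl fun i _ => ?_))
  simp [mul_assoc]

/-! ### As many quantization levels as symbols: half diversity -/

lemma InSector.star_iff {K : ℕ} {t : ℂ} : InSector K (star t) ↔ InSector K t := by
  unfold InSector; rw [star_star, and_comm]

/-- The cell centred at angle `π/K` has its edges at `0` and `2π/K`. The form for the first is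
exactly `Im y`; the other grows like `√ρ a sin (2π/K)`, except for `K = 2`, where it is again `Im
y`. -/
lemma eventually_inSector_of_im_pos {K : ℕ} (hK : 2 ≤ K) {a : ℝ} (ha : 0 < a) {y : ℂ}
    (hy : 0 < y.im) :
    ∀ᶠ ρ : ℝ in atTop,
      InSector K (((Real.sqrt ρ * a : ℝ) + y) * star (cis (Real.pi / K))) := by
  have hpi := Real.pi_pos
  have h2 : ∀ᶠ ρ : ℝ in atTop, 0 < (Real.sqrt ρ * a + y.re) * Real.sin (2 * (Real.pi / K))
      - y.im * Real.cos (2 * (Real.pi / K)) := by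
    rcases hK.eq_or_lt with rfl | hK3
    · refine Eventually.of_forall fun ρ => ?_
      have : 2 * (Real.pi / (2 : ℕ)) = Real.pi := by push_cast; ring
      rw [this, Real.sin_pi, Real.cos_pi]
      linarith
    · have hK3' : (3 : ℝ) ≤ K := by exact_mod_cast hK3
      have hs : 0 < Real.sin (2 * (Real.pi / K)) := by
        apply Real.sin_pos_of_pos_of_lt_pi (by positivity)
        have : Real.pi / K ≤ Real.pi / 3 := by gcongr
        linarith
      have h3 : Tendsto (fun ρ : ℝ => (Real.sqrt ρ * a + y.re) * Real.sin (2 * (Real.pi / K))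
          - y.im * Real.cos (2 * (Real.pi / K))) atTop atTop :=
        tendsto_atTop_add_const_right _ _ (Tendsto.atTop_mul_const hs
          (tendsto_atTop_add_const_right _ _ (Real.tendsto_sqrt_atTop.atTop_mul_const ha)))
      exact h3.eventually_gt_atTop 0
  filter_upwards [h2] with ρ hρ
  constructor
  · rw [star_cis, edge, mul_assoc, ← cis_add]
    simpa using hy
  · rw [star_mul', star_star, edge, mul_assoc, ← cis_add, ← two_mul]
    simp only [Complex.mul_im, cis_re, cis_im, Complex.star_def, Complex.conj_re, Complex.conj_im,
      Complex.add_re, Complex.add_im, Complex.ofReal_re, Complex.ofReal_im]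
    linarith

/-- Close to a cell boundary the quantizer reads off the sign of the normal component. -/
lemma IsPSKQuantizer.eventually_eq_of_im_ne_zero {K : ℕ} (hK : 2 ≤ K) {Q : ℂ → ℂ}
    (hQ : IsPSKQuantizer K (Real.pi / K) Q) {a : ℝ} (ha : 0 < a) {y : ℂ} (hy : y.im ≠ 0) :
    ∀ᶠ ρ : ℝ in atTop, Q ((Real.sqrt ρ * a : ℝ) + y)
      = if 0 < y.im then cis (Real.pi / K) else cis (-(Real.pi / K)) := by
  have hp0 : pskPt K (Real.pi / K) 0 = cis (Real.pi / K) := by simp [pskPt]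
  have hp1 : pskPt K (Real.pi / K) (-1) = cis (-(Real.pi / K)) := by
    unfold pskPt; congr 1; push_cast; ring
  rcases hy.lt_or_gt with h | h
  · rw [if_neg (not_lt.2 h.le)]
    filter_upwards [eventually_inSector_of_im_pos hK ha (y := star y) (by simpa using h)] with ρ hρ
    rw [← hp1]
    refine hQ.eq_of_inSector hK ?_
    rw [hp1, ← InSector.star_iff]
    convert hρ using 1
    rw [star_mul', star_star, star_add, star_cis]
    simp
  · rw [if_pos h]
    filter_upwards [eventually_inSector_of_im_pos hK ha h] with ρ hρ
    rw [← hp0]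
    refine hQ.eq_of_inSector hK ?_
    rwa [hp0]

lemma eventually_pos_or_eventually_not_pos (α β : ℝ) :
    (∀ᶠ ρ : ℝ in atTop, 0 < Real.sqrt ρ * α + β) ∨
      ∀ᶠ ρ : ℝ in atTop, ¬ 0 < Real.sqrt ρ * α + β := by
  rcases lt_trichotomy α 0 with h | h | h
  · right
    have h1 : Tendsto (fun ρ : ℝ => Real.sqrt ρ * α + β) atTop atBot :=
      tendsto_atBot_add_const_right _ _ (Real.tendsto_sqrt_atTop.atTop_mul_const_of_neg h)
    filter_upwards [h1.eventually_le_atBot 0] with ρ hρ using not_lt.2 hρ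
  · subst h
    by_cases hβ : 0 < β
    · left; exact Eventually.of_forall fun ρ => by simpa using hβ
    · right; exact Eventually.of_forall fun ρ => by simpa using hβ
  · left
    have h1 : Tendsto (fun ρ : ℝ => Real.sqrt ρ * α + β) atTop atTop :=
      tendsto_atTop_add_const_right _ _ (Real.tendsto_sqrt_atTop.atTop_mul_const h)
    exact h1.eventually_gt_atTop 0

lemma eventually_inSector_or_eventually_not (K : ℕ) (z0 z1 : ℂ) :
    (∀ᶠ ρ : ℝ in atTop, InSector K ((Real.sqrt ρ : ℂ) * z0 + z1)) ∨
      ∀ᶠ ρ : ℝ in atTop, ¬ InSector K ((Real.sqrt ρ : ℂ) * z0 + z1) := by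
  have e : ∀ ρ : ℝ, InSector K ((Real.sqrt ρ : ℂ) * z0 + z1) ↔
      0 < Real.sqrt ρ * edge (Real.pi / K) z0 + edge (Real.pi / K) z1 ∧
      0 < Real.sqrt ρ * edge (Real.pi / K) (star z0) + edge (Real.pi / K) (star z1) := by
    intro ρ
    have : star ((Real.sqrt ρ : ℂ) * z0 + z1) = (Real.sqrt ρ : ℂ) * star z0 + star z1 := by simp
    rw [InSector, this, edge_add, edge_add, edge_ofReal_mul, edge_ofReal_mul]
  simp only [e]
  rcases eventually_pos_or_eventually_not_pos (edge (Real.pi / K) z0) (edge (Real.pi / K) z1)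
    with h1 | h1
  · rcases eventually_pos_or_eventually_not_pos (edge (Real.pi / K) (star z0))
      (edge (Real.pi / K) (star z1)) with h2 | h2
    · exact Or.inl (h1.and h2)
    · exact Or.inr (h2.mono fun ρ h h' => h h'.2)
  · exact Or.inr (h1.mono fun ρ h h' => h h'.1)

/-- For even `K` the antipode `-1` is a constellation point, and `x` is no closer to it than to `1`.
-/
lemma IsPSKQuantizer.re_nonneg {K : ℕ} (hK : Even K) (hK2 : 2 ≤ K) {G : ℂ → ℂ}
    (hG : IsPSKQuantizer K 0 G) {x : ℂ} (hx : G x = 1) : 0 ≤ x.re := by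
  obtain ⟨k, rfl⟩ := hK
  have hk : (k : ℝ) ≠ 0 := by
    have : 1 ≤ k := by omega
    positivity
  have h := hG.re_mul_cis_le x k
  have e : 2 * Real.pi / ((k + k : ℕ) : ℝ) * ((k : ℤ) : ℝ) = Real.pi := by
    push_cast; field_simp; ring
  rw [hx, e, cis_pi] at h
  simp only [star_one, mul_one, mul_neg, Complex.neg_re] at h
  linarith

section HalfDiversity

variable {K N : ℕ} {Q G : Fin N → ℂ → ℂ}

/-- The error event on which the channel of every antenna lies in the cell of the chosen
boundary ray. -/
def boundaryErrorEvent (K : ℕ) (Q G : Fin N → ℂ → ℂ) (ρ : ℝ) :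
    Set ((Fin N → ℂ) × (Fin N → ℂ)) :=
  {p | (∀ i, G i ((Real.sqrt ρ : ℂ) * p.1 i) = 1) ∧
    ¬ InSector K (∑ i, star (p.1 i) * Q i ((Real.sqrt ρ : ℂ) * p.1 i + p.2 i))}

/-- The boundary error event in the variables in which the component normal to the boundary is
rescaled by the signal amplitude. -/
def scaledBoundaryErrorEvent (K : ℕ) (Q G : Fin N → ℂ → ℂ) (ρ : ℝ) :
    Set (((Fin N → ℝ) × (Fin N → ℂ)) × (Fin N → ℝ)) :=
  {z | (∀ i, G i (mkVec (Real.sqrt ρ • z.1.1) z.2 i) = 1) ∧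
    ¬ InSector K (∑ i, star (mkVec (Real.sqrt ρ • z.1.1) z.2 i) *
      Q i (mkVec (Real.sqrt ρ • z.1.1) z.2 i + z.1.2 i))}

lemma measurableSet_boundaryErrorEvent (hQm : ∀ i, Measurable (Q i)) (hGm : ∀ i, Measurable (G i))
    (ρ : ℝ) : MeasurableSet (boundaryErrorEvent K Q G ρ) := by
  have h1 : ∀ i, Measurable fun p : (Fin N → ℂ) × (Fin N → ℂ) => p.1 i := fun i =>
    (measurable_pi_apply i).comp measurable_fst
  have h2 : ∀ i, Measurable fun p : (Fin N → ℂ) × (Fin N → ℂ) => p.2 i := fun i =>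
    (measurable_pi_apply i).comp measurable_snd
  have h3 : MeasurableSet {p : (Fin N → ℂ) × (Fin N → ℂ) |
      ∀ i, G i ((Real.sqrt ρ : ℂ) * p.1 i) = 1} := by
    rw [Set.ofPred_forall]
    exact MeasurableSet.iInter fun i =>
      ((hGm i).comp ((h1 i).const_mul _)) (measurableSet_singleton 1)
  exact h3.inter (measurableSet_not_inSector K (Finset.measurable_sum _ fun i _ =>
    (continuous_star.measurable.comp (h1 i)).mul ((hQm i).comp (((h1 i).const_mul _).add (h2 i)))))

lemma measurableSet_scaledBoundaryErrorEvent (hQm : ∀ i, Measurable (Q i))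
    (hGm : ∀ i, Measurable (G i)) (ρ : ℝ) :
    MeasurableSet (scaledBoundaryErrorEvent K Q G ρ) := by
  have h0 : Measurable fun z : ((Fin N → ℝ) × (Fin N → ℂ)) × (Fin N → ℝ) =>
      (Real.sqrt ρ • z.1.1, z.2) := by fun_prop
  have h1 : ∀ i, Measurable fun z : ((Fin N → ℝ) × (Fin N → ℂ)) × (Fin N → ℝ) =>
      mkVec (Real.sqrt ρ • z.1.1) z.2 i := fun i =>
    (measurable_pi_apply i).comp (measurable_mkVec.comp h0)
  have h2 : ∀ i, Measurable fun z : ((Fin N → ℝ) × (Fin N → ℂ)) × (Fin N → ℝ) => z.1.2 i :=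
    fun i => (measurable_pi_apply i).comp (measurable_snd.comp measurable_fst)
  have h3 : MeasurableSet {z : ((Fin N → ℝ) × (Fin N → ℂ)) × (Fin N → ℝ) |
      ∀ i, G i (mkVec (Real.sqrt ρ • z.1.1) z.2 i) = 1} := by
    rw [Set.ofPred_forall]
    exact MeasurableSet.iInter fun i => ((hGm i).comp (h1 i)) (measurableSet_singleton 1)
  exact h3.inter (measurableSet_not_inSector K (Finset.measurable_sum _ fun i _ =>
    (continuous_star.measurable.comp (h1 i)).mul ((hQm i).comp ((h1 i).add (h2 i)))))

lemma mkVec_smul_apply (r : ℝ) (a u : Fin N → ℝ) (i : Fin N) :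
    mkVec (r • a) u i = ((r * a i : ℝ) : ℂ) + (u i : ℂ) * Complex.I := by
  apply Complex.ext <;> simp [mkVec]

lemma IsPSKQuantizer.eventually_eq_one (hK : 2 ≤ K) {G : ℂ → ℂ} (hG : IsPSKQuantizer K 0 G)
    {a : ℝ} (ha : 0 < a) (w : ℂ) : ∀ᶠ ρ : ℝ in atTop, G (((Real.sqrt ρ * a : ℝ) : ℂ) + w) = 1 := by
  have hp : pskPt K 0 0 = 1 := by simp [pskPt]
  have h : InSector K ((a : ℂ) * 1) := by
    have hs := sin_pi_div_pos hK
    constructor <;> simp [edge_def, ha, hs]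
  filter_upwards [h.eventually_sqrt_mul_add w] with ρ hρ
  rw [← hp]
  refine hG.eq_of_inSector hK ?_
  rw [hp, star_one]
  push_cast
  exact hρ

/-- In the scaled variables the error event eventually stabilizes. -/
lemma eventually_mem_or_eventually_notMem (hK : Even K) (hK2 : 2 ≤ K)
    (hQ : ∀ i, IsPSKQuantizer K (Real.pi / K) (Q i)) (hG : ∀ i, IsPSKQuantizer K 0 (G i))
    {a u : Fin N → ℝ} {w : Fin N → ℂ} (ha : ∀ i, a i ≠ 0) (hu : ∀ i, u i + (w i).im ≠ 0) :
    (∀ᶠ ρ in atTop, ((a, w), u) ∈ scaledBoundaryErrorEvent K Q G ρ) ∨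
      ∀ᶠ ρ in atTop, ((a, w), u) ∉ scaledBoundaryErrorEvent K Q G ρ := by
  by_cases hpos : ∀ i, 0 < a i
  · set r : Fin N → ℂ := fun i =>
      if 0 < u i + (w i).im then cis (Real.pi / K) else cis (-(Real.pi / K)) with hr
    have h1 : ∀ᶠ ρ : ℝ in atTop, ∀ i, G i (mkVec (Real.sqrt ρ • a) u i) = 1 := by
      refine eventually_all.2 fun i => ?_
      simp only [mkVec_smul_apply]
      exact (hG i).eventually_eq_one hK2 (hpos i) _
    have h2 : ∀ᶠ ρ : ℝ in atTop, ∀ i, Q i (mkVec (Real.sqrt ρ • a) u i + w i) = r i := by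
      refine eventually_all.2 fun i => ?_
      simp only [mkVec_smul_apply, add_assoc]
      have him : ((u i : ℂ) * Complex.I + w i).im = u i + (w i).im := by simp
      have := (hQ i).eventually_eq_of_im_ne_zero hK2 (hpos i)
        (y := (u i : ℂ) * Complex.I + w i) (by rw [him]; exact hu i)
      rwa [him] at this
    have h3 : ∀ ρ : ℝ, ∑ i, star (mkVec (Real.sqrt ρ • a) u i) * r i
        = (Real.sqrt ρ : ℂ) * ∑ i, (a i : ℂ) * r i + ∑ i, star ((u i : ℂ) * Complex.I) * r i := by
      intro ρ
      rw [Finset.mul_sum, ← Finset.sum_add_distrib]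
      refine Finset.sum_congr rfl fun i _ => ?_
      rw [mkVec_smul_apply]
      simp
      ring
    -- If all `r i` agree, the leading sum lies on an edge of the sector and the constant term
    -- decides. Both edge conditions are affine in `√ρ`, so their truth values stabilize.
    rcases eventually_inSector_or_eventually_not K (∑ i, (a i : ℂ) * r i)
      (∑ i, star ((u i : ℂ) * Complex.I) * r i) with h4 | h4
    · right
      filter_upwards [h2, h4] with ρ e2 e4 hmem
      have := hmem.2
      simp only [e2, h3] at this
      exact this e4
    · left
      filter_upwards [h1, h2, h4] with ρ e1 e2 e4
      refine ⟨e1, ?_⟩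
      simp only [e2, h3]
      exact e4
  · right
    push Not at hpos
    obtain ⟨i, hi⟩ := hpos
    filter_upwards [eventually_gt_atTop 0] with ρ hρ hmem
    have h := (hG i).re_nonneg hK hK2 (hmem.1 i)
    rw [mkVec_smul_apply] at h
    simp at h
    have h1 : a i < 0 := lt_of_le_of_ne hi (ha i)
    have h2 : 0 < Real.sqrt ρ := Real.sqrt_pos.2 hρ
    nlinarith

/-- Each channel lies just below the boundary ray and the noise lifts each output above it, so all
antennas err towards the same edge. -/
lemma eventually_mem_scaledBoundaryErrorEvent (hK2 : 2 ≤ K)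
    (hQ : ∀ i, IsPSKQuantizer K (Real.pi / K) (Q i)) (hG : ∀ i, IsPSKQuantizer K 0 (G i))
    {a u : Fin N → ℝ} {w : Fin N → ℂ} (ha : ∀ i, 0 < a i) (hu : ∀ i, u i < 0)
    (hw : ∀ i, 0 < u i + (w i).im) :
    ∀ᶠ ρ in atTop, ((a, w), u) ∈ scaledBoundaryErrorEvent K Q G ρ := by
  have h1 : ∀ᶠ ρ : ℝ in atTop, ∀ i, G i (mkVec (Real.sqrt ρ • a) u i) = 1 := by
    refine eventually_all.2 fun i => ?_
    simp only [mkVec_smul_apply]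
    exact (hG i).eventually_eq_one hK2 (ha i) _
  have h2 : ∀ᶠ ρ : ℝ in atTop, ∀ i,
      Q i (mkVec (Real.sqrt ρ • a) u i + w i) = cis (Real.pi / K) := by
    refine eventually_all.2 fun i => ?_
    simp only [mkVec_smul_apply, add_assoc]
    have him : ((u i : ℂ) * Complex.I + w i).im = u i + (w i).im := by simp
    have := (hQ i).eventually_eq_of_im_ne_zero hK2 (ha i)
      (y := (u i : ℂ) * Complex.I + w i) (by rw [him]; exact (hw i).ne')
    rwa [him, if_pos (hw i)] at this
  filter_upwards [h1, h2] with ρ e1 e2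
  refine ⟨e1, ?_⟩
  simp only [e2]
  refine not_inSector_of_edge_star_nonpos fun i => ?_
  rw [← star_mul_star_eq, star_star, edge, mul_assoc, star_mul_cis, mul_one]
  exact (hu i).le

lemma norm_le_of_mem_scaledBoundaryErrorEvent (hK : Even K) (hK2 : 2 ≤ K)
    (hQ : ∀ i, IsPSKQuantizer K (Real.pi / K) (Q i)) (hG : ∀ i, IsPSKQuantizer K 0 (G i)) {ρ : ℝ}
    {z : ((Fin N → ℝ) × (Fin N → ℂ)) × (Fin N → ℝ)}
    (hz : z ∈ scaledBoundaryErrorEvent K Q G ρ) : ‖z.2‖ ≤ 2 * ∑ i, ‖z.1.2 i‖ := by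
  have h0 : 0 ≤ ∑ i, ‖z.1.2 i‖ := Finset.sum_nonneg fun _ _ => norm_nonneg _
  rw [pi_norm_le_iff_of_nonneg (by positivity)]
  intro i
  exact abs_im_le_of_not_inSector hK hK2 hQ hG hz.1 hz.2 i

/-- Only the channel is split: the normal component comes last, ready for rescaling, while the
tangential one joins the noise in the fixed probability space. -/
lemma measurePreserving_splitChannel (N : ℕ) :
    MeasurePreserving
      (fun z : ((Fin N → ℝ) × (Fin N → ℂ)) × (Fin N → ℝ) => (mkVec z.1.1 z.2, z.1.2))
      (((realGaussianVec N).prod (complexGaussianVec N)).prod (realGaussianVec N))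
      ((complexGaussianVec N).prod (complexGaussianVec N)) := by
  have h1 := measurePreserving_prodAssoc (realGaussianVec N) (complexGaussianVec N)
    (realGaussianVec N)
  have h2 := (MeasurePreserving.id (realGaussianVec N)).prod
    (Measure.measurePreserving_swap (μ := complexGaussianVec N) (ν := realGaussianVec N))
  have h3 := (measurePreserving_prodAssoc (realGaussianVec N) (realGaussianVec N)
    (complexGaussianVec N)).symm
  have h4 := (measurePreserving_mkVec N).prod (MeasurePreserving.id (complexGaussianVec N))
  exact h4.comp (h3.comp (h2.comp h1))

lemma realGaussianVec_pi_ne_zero (N : ℕ) {U : Set ℝ} (hU : IsOpen U) (hne : U.Nonempty) :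
    realGaussianVec N (Set.univ.pi fun _ => U) ≠ 0 := by
  rw [realGaussianVec, Measure.pi_pi]
  refine Finset.prod_ne_zero_iff.2 fun _ _ h => ?_
  exact (hU.measure_pos volume hne).ne' (gaussianReal_absolutelyContinuous' 0 (by norm_num) h)

/-- The normal components are confined to the noise scale, while the tangential ones keep their
Gaussian law. Only `N` real coordinates are rescaled, hence the exponent `N / 2`. -/
theorem tendsto_boundaryErrorEvent (hK : Even K) (hK2 : 2 ≤ K)
    (hQ : ∀ i, IsPSKQuantizer K (Real.pi / K) (Q i)) (hG : ∀ i, IsPSKQuantizer K 0 (G i))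
    (hQm : ∀ i, Measurable (Q i)) (hGm : ∀ i, Measurable (G i)) :
    ∃ c : ℝ, 0 < c ∧ Tendsto (fun ρ : ℝ => ρ ^ ((N : ℝ) / 2) *
      ((complexGaussianVec N).prod (complexGaussianVec N)).real (boundaryErrorEvent K Q G ρ))
      atTop (nhds c) := by
  let P := (realGaussianVec N).prod (complexGaussianVec N)
  have hPprob : IsProbabilityMeasure P := by
    change IsProbabilityMeasure ((realGaussianVec N).prod (complexGaussianVec N)); infer_instance
  have hTm : Measurable fun z : (Fin N → ℝ) × (Fin N → ℂ) => 2 * ∑ i, ‖z.2 i‖ := by fun_prop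
  have hT0 : ∀ z : (Fin N → ℝ) × (Fin N → ℂ), 0 ≤ 2 * ∑ i, ‖z.2 i‖ := fun w =>
    mul_nonneg two_pos.le (Finset.sum_nonneg fun _ _ => norm_nonneg _)
  have hS := prod_closedBall_ne_top (E := Fin N → ℝ) P volume hTm hT0 (by
    simp_rw [mul_pow]
    exact ((integrable_sum_norm_pow N _).comp_snd (realGaussianVec N)).const_mul _)
  have hae : ∀ᵐ z ∂(P.prod (volume : Measure (Fin N → ℝ))),
      (∀ i, z.1.1 i ≠ 0) ∧ ∀ i, z.2 i + (z.1.2 i).im ≠ 0 := by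
    refine Filter.Eventually.and ?_ ?_
    · rw [ae_all_iff]
      intro i
      refine Measure.quasiMeasurePreserving_fst.ae
        (p := fun z : (Fin N → ℝ) × (Fin N → ℂ) => z.1 i ≠ 0) ?_
      refine Measure.quasiMeasurePreserving_fst.ae (p := fun a : Fin N → ℝ => a i ≠ 0) ?_
      refine (measurePreserving_eval (fun _ : Fin N => gaussianReal 0 (1 / 2))
        i).quasiMeasurePreserving.ae (p := fun x : ℝ => x ≠ 0) ?_
      exact (gaussianReal_absolutelyContinuous 0 (by norm_num)).ae_le (Measure.ae_ne volume 0)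
    · rw [ae_all_iff]
      intro i
      have hm : MeasurableSet {z : ((Fin N → ℝ) × (Fin N → ℂ)) × (Fin N → ℝ) |
          z.2 i + (z.1.2 i).im = 0} := by
        refine measurableSet_eq_fun ?_ measurable_const
        exact ((measurable_pi_apply i).comp measurable_snd).add (Complex.measurable_im.comp
          ((measurable_pi_apply i).comp (measurable_snd.comp measurable_fst)))
      rw [ae_iff]
      simp only [ne_eq, not_not]
      rw [Measure.measure_prod_null hm]
      refine Eventually.of_forall fun ω => ?_
      have h := Measure.pi_hyperplane (fun _ : Fin N => (volume : Measure ℝ)) i (-(ω.2 i).im)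
      rw [← volume_pi] at h
      refine measure_mono_null (fun u hu => ?_) h
      exact eq_neg_of_add_eq_zero_left hu
  let B : Set (((Fin N → ℝ) × (Fin N → ℂ)) × (Fin N → ℝ)) :=
    ((Set.univ.pi fun _ => Set.Ioi 0) ×ˢ (Set.univ.pi fun _ => {w : ℂ | 2 < w.im})) ×ˢ
      (Set.univ.pi fun _ => Set.Ioo (-2) (-1))
  have hopen : IsOpen {w : ℂ | 2 < w.im} := isOpen_lt continuous_const Complex.continuous_im
  have hB : MeasurableSet B :=
    ((MeasurableSet.univ_pi fun _ => measurableSet_Ioi).prod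
      (MeasurableSet.univ_pi fun _ => hopen.measurableSet)).prod
      (MeasurableSet.univ_pi fun _ => measurableSet_Ioo)
  have hB0 : (P.prod (volume : Measure (Fin N → ℝ))) B ≠ 0 := by
    rw [Measure.prod_prod, Measure.prod_prod]
    refine mul_ne_zero (mul_ne_zero (realGaussianVec_pi_ne_zero N isOpen_Ioi ⟨1, by simp⟩)
      (complexGaussianVec_pi_ne_zero N hopen ⟨⟨0, 3⟩, by norm_num⟩)) ?_
    rw [volume_pi, Measure.pi_pi]
    exact Finset.prod_ne_zero_iff.2 fun _ _ => by rw [Real.volume_Ioo]; norm_num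
  obtain ⟨k, hk, hlim⟩ := tendsto_rpow_mul_measureReal_scaled P
    (volume : Measure (Fin N → ℝ)) (q := fun z => ∑ i, z i ^ 2) (by fun_prop)
    (fun z => Finset.sum_nonneg fun i _ => by positivity)
    (fun t z => by
      rw [Finset.mul_sum]
      refine Finset.sum_congr rfl fun i _ => ?_
      rw [Pi.smul_apply, smul_eq_mul, mul_pow])
    (C := (Real.sqrt Real.pi)⁻¹ ^ N) (by have := Real.pi_pos; positivity)
    (A := scaledBoundaryErrorEvent K Q G)
    (measurableSet_scaledBoundaryErrorEvent hQm hGm) hS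
    (fun _ _ z hz => norm_le_of_mem_scaledBoundaryErrorEvent hK hK2 hQ hG hz)
    (by
      filter_upwards [hae] with z hz
      exact eventually_mem_or_eventually_notMem hK hK2 hQ hG hz.1 hz.2)
    hB hB0 (by
      rintro ⟨⟨a, w⟩, u⟩ ⟨⟨ha, hw⟩, hu⟩
      refine eventually_mem_scaledBoundaryErrorEvent hK2 hQ hG (fun i => ha i trivial)
        (fun i => (hu i trivial).2.trans (by norm_num)) fun i => ?_
      have h1 := (hu i trivial).1
      have h2 : 2 < (w i).im := hw i trivial
      linarith)
  refine ⟨k, hk, hlim.congr' ?_⟩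
  filter_upwards [eventually_gt_atTop 0] with ρ hρ
  have hr : 0 < Real.sqrt ρ := Real.sqrt_pos.2 hρ
  rw [← realGaussianVec_eq_withDensity, Module.finrank_fin_fun]
  congr 1
  have hsw := (measurePreserving_splitChannel N).measure_preimage
      (measurableSet_boundaryErrorEvent hQm hGm ρ (K := K)).nullMeasurableSet
  rw [Measure.real, Measure.real, ← hsw]
  congr 2
  ext z
  have hx : ∀ i, mkVec (Real.sqrt ρ • z.1.1) (Real.sqrt ρ • z.2) i
      = (Real.sqrt ρ : ℂ) * mkVec z.1.1 z.2 i := by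
    intro i
    apply Complex.ext <;> simp [mkVec]
  change ((∀ i, G i (mkVec (Real.sqrt ρ • z.1.1) (Real.sqrt ρ • z.2) i) = 1) ∧ _) ↔
    ((∀ i, G i ((Real.sqrt ρ : ℂ) * mkVec z.1.1 z.2 i) = 1) ∧ _)
  simp only [hx]
  refine and_congr_right fun _ => not_congr ?_
  rw [← InSector.ofReal_mul hr (t := ∑ i, star (mkVec z.1.1 z.2 i) * _), Finset.mul_sum]
  refine iff_of_eq (congrArg _ (Finset.sum_congr rfl fun i _ => ?_))
  simp [mul_assoc]

end HalfDiversity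

lemma IsPSKQuantizer.rotate_pskPt {K : ℕ} {β γ : ℝ} {Q : ℂ → ℂ} (hQ : IsPSKQuantizer K β Q)
    (k : ℤ) : IsPSKQuantizer K (β - γ) (fun y => star (pskPt K γ k) * Q (pskPt K γ k * y)) := by
  have h := (hQ.rotate (γ + 2 * Real.pi / K * k)).shift k
  rwa [show β - (γ + 2 * Real.pi / K * k) + 2 * Real.pi / K * k = β - γ by ring] at h

/-- The cell boundaries of `Q` are the rays through the points with initial angle `γ = β - π / K`,
and `G` selects the nearest one for each antenna. Rotating channel and noise together moves the
selected ray to the positive real axis and leaves `star (h i) * Q (y i)` unchanged. Finitely many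
selections each contribute a positive constant. -/
theorem tendsto_half_diversity {K N : ℕ} (hK : Even K) (hK2 : 2 ≤ K) {β : ℝ}
    {Q : ℂ → ℂ} (hQ : IsPSKQuantizer K β Q) (hQm : Measurable Q) :
    ∃ c : ℝ, 0 < c ∧ Tendsto (fun ρ : ℝ => ρ ^ ((N : ℝ) / 2) *
      ((complexGaussianVec N).prod (complexGaussianVec N)).real (errorEvent K N Q ρ))
      atTop (nhds c) := by
  classical
  set ν := (complexGaussianVec N).prod (complexGaussianVec N)
  set γ := β - Real.pi / K with hγ
  obtain ⟨G, hGm, hG⟩ := exists_measurable_isPSKQuantizer K (by omega) γ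
  have hfin := finite_range_pskPt K (by omega) γ
  let R := (Set.range (pskPt K γ))
  have : Fintype R := hfin.fintype
  let F : (Fin N → R) → ℝ → Set ((Fin N → ℂ) × (Fin N → ℂ)) := fun ζ ρ =>
    {p | (∀ i, G ((Real.sqrt ρ : ℂ) * p.1 i) = ζ i) ∧ p ∈ errorEvent K N Q ρ}
  have hFm : ∀ ζ ρ, MeasurableSet (F ζ ρ) := by
    intro ζ ρ
    have h3 : MeasurableSet {p : (Fin N → ℂ) × (Fin N → ℂ) |
        ∀ i, G ((Real.sqrt ρ : ℂ) * p.1 i) = ζ i} := by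
      rw [Set.ofPred_forall]
      exact MeasurableSet.iInter fun i => (hGm.comp
        (((measurable_pi_apply i).comp measurable_fst).const_mul _)) (measurableSet_singleton _)
    exact h3.inter (measurableSet_errorEvent K N hQm ρ)
  have hsum : ∀ ρ, ν.real (errorEvent K N Q ρ) = ∑ ζ, ν.real (F ζ ρ) := by
    intro ρ
    rw [← measureReal_iUnion_fintype (μ := ν) (f := fun ζ => F ζ ρ) ?_ (fun ζ => hFm ζ ρ)]
    · congr 1
      ext p
      simp only [Set.mem_iUnion]
      constructor
      · intro hp
        have h : ∀ i, G ((Real.sqrt ρ : ℂ) * p.1 i) ∈ R := fun i => by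
          obtain ⟨k, hk⟩ := (hG ((Real.sqrt ρ : ℂ) * p.1 i)).1
          exact ⟨k, hk.symm⟩
        exact ⟨fun i => ⟨_, h i⟩, fun i => rfl, hp⟩
      · rintro ⟨ζ, -, hp⟩; exact hp
    · intro ζ ζ' hne
      refine Set.disjoint_left.2 fun p hp hp' => hne ?_
      funext i
      exact Subtype.ext ((hp.1 i).symm.trans (hp'.1 i))
  have hterm : ∀ ζ, ∃ c : ℝ, 0 < c ∧
      Tendsto (fun ρ : ℝ => ρ ^ ((N : ℝ) / 2) * ν.real (F ζ ρ)) atTop (nhds c) := by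
    intro ζ
    choose k hk using fun i => (ζ i).2
    have hQ' : ∀ i, IsPSKQuantizer K (Real.pi / K)
        (fun y => star (pskPt K γ (k i)) * Q (pskPt K γ (k i) * y)) := fun i => by
      have h := hQ.rotate_pskPt (γ := γ) (k i)
      rwa [show β - γ = Real.pi / K by rw [hγ]; ring] at h
    have hG' : ∀ i, IsPSKQuantizer K 0
        (fun y => star (pskPt K γ (k i)) * G (pskPt K γ (k i) * y)) := fun i => by
      have h := hG.rotate_pskPt (γ := γ) (k i)
      rwa [sub_self] at h
    obtain ⟨c, hc, hlim⟩ := tendsto_boundaryErrorEvent hK hK2 hQ' hG'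
      (fun i => (hQm.comp (measurable_const_mul _)).const_mul _)
      (fun i => (hGm.comp (measurable_const_mul _)).const_mul _)
    refine ⟨c, hc, hlim.congr fun ρ => ?_⟩
    congr 1
    have hmp := (measurePreserving_cis_mul_vec (N := N)
      fun i => γ + 2 * Real.pi / K * k i).prod (measurePreserving_cis_mul_vec (N := N)
      fun i => γ + 2 * Real.pi / K * k i)
    rw [Measure.real, Measure.real, ← hmp.measure_preimage (hFm ζ ρ).nullMeasurableSet]
    congr 2
    ext p
    have hone : ∀ i, pskPt K γ (k i) * star (pskPt K γ (k i)) = 1 := fun i => cis_mul_star _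
    have hG1 : ∀ i, (star (pskPt K γ (k i)) * G (pskPt K γ (k i) * ((Real.sqrt ρ : ℂ) * p.1 i)) = 1
        ↔ G ((Real.sqrt ρ : ℂ) * (pskPt K γ (k i) * p.1 i)) = ζ i) := by
      intro i
      rw [← hk i, mul_left_comm]
      constructor
      · intro h
        linear_combination (pskPt K γ (k i)) * h -
          G ((Real.sqrt ρ : ℂ) * (pskPt K γ (k i) * p.1 i)) * hone i
      · intro h
        linear_combination star (pskPt K γ (k i)) * h + hone i
    refine and_congr (forall_congr' hG1) (not_congr ?_)
    refine iff_of_eq (congrArg _ (Finset.sum_congr rfl fun i _ => ?_))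
    change star (p.1 i) * (star (pskPt K γ (k i)) * Q (pskPt K γ (k i) * _))
      = star (pskPt K γ (k i) * p.1 i) *
        Q ((Real.sqrt ρ : ℂ) * (pskPt K γ (k i) * p.1 i) + pskPt K γ (k i) * p.2 i)
    rw [star_mul', mul_add, mul_left_comm (pskPt K γ (k i)) (Real.sqrt ρ : ℂ)]
    ring
  choose c hc hlim using hterm
  have hR : Nonempty (Fin N → R) := ⟨fun _ => ⟨pskPt K γ 0, 0, rfl⟩⟩
  refine ⟨∑ ζ, c ζ, Finset.sum_pos (fun ζ _ => hc ζ) Finset.univ_nonempty, ?_⟩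
  refine (tendsto_finsetSum Finset.univ fun ζ _ => hlim ζ).congr fun ρ => ?_
  rw [hsum, Finset.mul_sum]

lemma hasDiversityGain_of_tendsto {P : ℝ → ℝ} {d c : ℝ} (hc : 0 < c)
    (h : Tendsto (fun ρ => ρ ^ d * P ρ) atTop (nhds c)) : HasDiversityGain P d := by
  refine ⟨c, hc, isEquivalent_of_tendsto_one ?_⟩
  have h1 := h.div_const c
  rw [div_self hc.ne'] at h1
  refine h1.congr' ?_
  filter_upwards [eventually_gt_atTop 0] with ρ hρ
  have := Real.rpow_pos_of_pos hρ d
  rw [Pi.div_apply, Real.rpow_neg hρ.le]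
  field_simp

theorem corollary1 (n M Nr : ℕ) (hM : 2 ≤ M) (hNr : 1 ≤ Nr) (Q D : ℂ → ℂ)
    (hQ : IsPhaseQuantizer (2 ^ n) Q) (hD : IsPhaseQuantizer M D) :
    HasDiversityGain (averageSEP M Nr Q D)
      (if 2 ^ n < M then 0 else if 2 ^ n = M then (Nr : ℝ) / 2 else (Nr : ℝ)) := by
  have hK : 1 ≤ 2 ^ n := Nat.one_le_two_pow
  have hQ1 := hQ.isPSKQuantizer hK
  have hD1 := hD.isPSKQuantizer (by omega)
  obtain ⟨Q', hQm, hQ'⟩ := exists_measurable_isPSKQuantizer (2 ^ n) hK (Real.pi / 4)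
  rw [show averageSEP M Nr Q D = fun ρ => ((complexGaussianVec Nr).prod
    (complexGaussianVec Nr)).real (errorEvent M Nr Q' ρ) from
      funext fun ρ => averageSEP_eq hK hM hNr hQ1 hQ' hQm hD1 ρ]
  split_ifs with h1 h2
  · obtain ⟨c, hc, hlim⟩ := tendsto_error_floor (N := Nr) hK h1 hQ' hQm
    exact hasDiversityGain_of_tendsto hc (by simpa using hlim)
  · subst h2
    -- Since `M ≥ 2`, equality `2 ^ n = M` excludes `n = 0`, so the number of levels is even, as the
    -- antipodal argument requires.
    have hn : n ≠ 0 := by rintro rfl; simp at hM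
    obtain ⟨c, hc, hlim⟩ := tendsto_half_diversity (N := Nr)
      (even_two.pow_of_ne_zero hn) hM hQ' hQm
    exact hasDiversityGain_of_tendsto hc hlim
  · obtain ⟨c, hc, hlim⟩ := tendsto_full_diversity (N := Nr) hM (by omega) hQ' hQm
    exact hasDiversityGain_of_tendsto hc hlim
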